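/- Notation. Fix $T>0$ and let $V$ be a finite-dimensional normed space. Let $\mathcal C_1(V)$ be the set of continuous functions $[0,T]\to V$; let $\mathcal C_2(V)$ be the set of continuous $g:[0,T]^2\to V$ with $g_{ss}=0$; let $\mathcal C_3(V)$ be the set of continuous $h:[0,T]^3\to V$ with $h_{sst}=h_{stt}=0$. Put $(\delta f)_{st}=f_t-f_s$ and $(\delta g)_{sut}=g_{st}-g_{su}-g_{ut}$. For $\mu>0$ put $\|g\|_\mu=\sup_{s\ne t}|g_{st}|/|t-s|^\mu$, $\mathcal C_2^\mu=\{g\in\mathcal C_2:\|g\|_\mu<\infty\}$, $\mathcal C_1^\mu=\{f\in\mathcal C_1:\|\delta f\|_\mu<\infty\}$ and $\|f\|_{\mu,\infty,T}=\sup_t|f_t|+\|\delta f\|_\mu$. Let $\mathcal C_3^\mu$ be the set of $h\in\mathcal C_3$ that can be written as $h=\sum_{i\in\mathbb N} h_i$ with $h_i\in\mathcal C_3$, $0<\rho_i<\mu$ and $\sum_i \sup_{s,u,t}|(h_i)_{sut}|\,|u-s|^{-\rho_i}|t-u|^{-(\mu-\rho_i)}<\infty$ (supremum over $s\neq u\neq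 t$). For $h\in\mathcal C_3^\mu$ with $\mu>1$ that has zero coboundary ($h_{uvt}-h_{svt}+h_{sut}-h_{suv}=0$ for all $s,u,v,t$), let $\Lambda h$ be the unique element of $\mathcal C_2^\mu$ with $\delta(\Lambda h)=h$. Rough paths. Let $\tfrac13<\gamma\le1$. A $\gamma$-Hölder path with Lévy area is a pair $(x,\mathbf x^2)$ with $x\in\mathcal C_1^\gamma(\mathbb R^m)$ and $\mathbf x^2\in\mathcal C_2^{2\gamma}(\mathbb R^{m,m})$ such that $(\delta\mathbf x^2)_{sut}(i,j)=(\delta x^i)_{su}(\delta x^j)_{ut}$ for all $s,u,t\in[0,T]$ and all $i,j$. Controlled paths. Let $\tfrac13<\kappa\le\gamma$ and $a\in\mathbb R^d$. The space $\mathcal Q^x_{\kappa,a}$ consists of the couples $(z,\zeta)$ with $z\in\mathcal C_1^\kappa(\mathbb R^d)$, $z_0=a$, $\zeta\in\mathcal C_1^\kappa(\mathbb R^{d,m})$, such that $r_{st}:=(\delta z)_{st}-\zeta_s(\delta x)_{st}$ lies in $\mathcal C_2^{2\kappa}(\mathbb R^d)$. Put $\mathcal N[(z,\zeta);\mathcal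 Q^x_{\kappa,a}]=\|\delta z\|_\kappa+\sup_t|\zeta_t|+\|\delta\zeta\|_\kappa+\|r\|_{2\kappa}$. Solutions. A solution in $\mathcal Q^x_{\kappa,a}$ of $dy_t=\sigma(y_t)\,dx_t$, $y_0=a$, is a couple $(y,\zeta)\in\mathcal Q^x_{\kappa,a}$ with $\zeta=\sigma(y)$ such that, with $$g_{st}=\sigma(y_s)(\delta x)_{st}+\sum_{i,j=1}^m \big(D\sigma(y_s)[\zeta_s e_i]\big)e_j\;\mathbf x^2_{st}(i,j),$$ the increment $\delta g$ lies in $\mathcal C_3^{\mu}$ for some $\mu>1$ and $\delta y=g-\Lambda\delta g$. Theorem. Let $\tfrac13<\kappa<\gamma\le1$, let $\sigma\in C^3(\mathbb R^d;\mathbb R^{d,m})$ be bounded with bounded derivatives up to order $3$, and let $T>0$. (1) There is a polynomial $P_T:\mathbb R^2\to\mathbb R^+$ such that, for every $a\in\mathbb R^d$ and every $\gamma$-Hölder path $x$ with Lévy area $\mathbf x^2$, the equation $dy=\sigma(y)\,dx$, $y_0=a$, has a unique solution $(y,\zeta)$ in $\mathcal Q^x_{\kappa,a}$, and $$\mathcal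 N[(y,\zeta);\mathcal Q^x_{\kappa,a}]\le P_T\big(\|x\|_{\gamma,\infty,T},\|\mathbf x^2\|_{2\gamma}\big).$$ (2) The solution satisfies $y\in\mathcal C_1^\gamma(\mathbb R^d)$, and the map $(a,x,\mathbf x^2)\mapsto y$ is locally Lipschitz in the following sense: there is a function $K_T:\mathbb R^4\to\mathbb R^+$, increasing in each variable, such that for all $(a,x,\mathbf x^2)$ and $(\tilde a,\tilde x,\tilde{\mathbf x}^2)$ as in (1), with solutions $y$ and $\tilde y$, $$\|y-\tilde y\|_{\gamma,\infty,T}\le K_T\big(\|x\|_{\gamma,\infty,T},\|\tilde x\|_{\gamma,\infty,T},\|\mathbf x^2\|_{2\gamma},\|\tilde{\mathbf x}^2\|_{2\gamma}\big)\Big(|a-\tilde a|+\|x-\tilde x\|_{\gamma,\infty,T}+\|\mathbf x^2-\tilde{\mathbf x}^2\|_{2\gamma}\Big).$$ -/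

import Mathlib

open Set

noncomputable section

namespace RDE

/-- The Euclidean space `ℝⁿ`. -/
abbrev Vec (n : ℕ) : Type := EuclideanSpace ℝ (Fin n)

/-- The space `ℝ^{d,m}` of `d × m` matrices, as linear maps from `ℝᵐ` to `ℝᵈ`. -/
abbrev Mat (d m : ℕ) : Type := Vec m →L[ℝ] Vec d

/-- The space `ℝ^{m,m}` in which Lévy areas take their values: families `(A (i, j))` of real
numbers, with the Euclidean (Frobenius) norm. -/
abbrev Area (m : ℕ) : Type := EuclideanSpace ℝ (Fin m × Fin m)

/-- Paths `[0,T] → V`. -/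
abbrev Path1 (T : ℝ) (V : Type) : Type := Icc (0 : ℝ) T → V

/-- Functions of two variables `s, t ∈ [0,T]`. -/
abbrev Path2 (T : ℝ) (V : Type) : Type := Icc (0 : ℝ) T → Icc (0 : ℝ) T → V

/-- Functions of three variables `s, u, t ∈ [0,T]`. -/
abbrev Path3 (T : ℝ) (V : Type) : Type :=
  Icc (0 : ℝ) T → Icc (0 : ℝ) T → Icc (0 : ℝ) T → V

section Increments

variable {T : ℝ} {V : Type} [NormedAddCommGroup V]

/-- `(δf)_{st} = f_t - f_s`. -/
def delta1 (f : Path1 T V) : Path2 T V := fun s t => f t - f s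

/-- `(δg)_{sut} = g_{st} - g_{su} - g_{ut}`. -/
def delta2 (g : Path2 T V) : Path3 T V := fun s u t => g s t - g s u - g u t

/-- The quotients `|g_{st}| / |t - s|^μ` whose supremum is the Hölder norm (the value at `s = t`
is `0` for `μ > 0`, in accordance with `g_{ss} = 0`). -/
def quot2 (μ : ℝ) (g : Path2 T V) (p : Icc (0 : ℝ) T × Icc (0 : ℝ) T) : ℝ :=
  ‖g p.1 p.2‖ / |(p.2 : ℝ) - (p.1 : ℝ)| ^ μ

/-- `‖g‖_μ = sup_{s,t} |g_{st}| / |t - s|^μ`; meaningful for `g ∈ 𝓒₂^μ`. -/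
def norm2 (μ : ℝ) (g : Path2 T V) : ℝ := ⨆ p, quot2 μ g p

/-- `g ∈ 𝓒₂^μ(V)`: `g` is continuous, vanishes on the diagonal, and `‖g‖_μ < ∞`. -/
structure MemC2 (μ : ℝ) (g : Path2 T V) : Prop where
  continuous : Continuous fun p : Icc (0 : ℝ) T × Icc (0 : ℝ) T => g p.1 p.2
  diag : ∀ s, g s s = 0
  bddAbove : BddAbove (range (quot2 μ g))

/-- `f ∈ 𝓒₁^μ(V)`: `f` is continuous and `‖δf‖_μ < ∞`. -/
structure MemC1 (μ : ℝ) (f : Path1 T V) : Prop where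
  continuous : Continuous f
  bddAbove : BddAbove (range (quot2 μ (delta1 f)))

/-- `𝓝[f; 𝓒₁⁰] = sup_t |f_t|`. -/
def supNorm (f : Path1 T V) : ℝ := ⨆ t, ‖f t‖

/-- The full Hölder norm `‖f‖_{μ,∞,T} = sup_t |f_t| + ‖δf‖_μ` of a path. -/
def holderNorm (μ : ℝ) (f : Path1 T V) : ℝ := supNorm f + norm2 μ (delta1 f)

/-- The quotients `|h_{sut}| / (|u - s|^ρ |t - u|^ρ')`. -/
def quot3 (ρ ρ' : ℝ) (h : Path3 T V)
    (p : Icc (0 : ℝ) T × Icc (0 : ℝ) T × Icc (0 : ℝ) T) : ℝ :=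
  ‖h p.1 p.2.1 p.2.2‖ /
    (|(p.2.1 : ℝ) - (p.1 : ℝ)| ^ ρ * |(p.2.2 : ℝ) - (p.2.1 : ℝ)| ^ ρ')

/-- `h ∈ 𝓒₃(V)`: `h` is continuous and `h_{sut} = 0` if `s = u` or `u = t`. -/
structure IsIncr3 (h : Path3 T V) : Prop where
  continuous : Continuous fun p : Icc (0 : ℝ) T × Icc (0 : ℝ) T × Icc (0 : ℝ) T =>
    h p.1 p.2.1 p.2.2
  diag_left : ∀ s t, h s s t = 0
  diag_right : ∀ s t, h s t t = 0

/-- `h ∈ 𝓒₃^μ(V)`: `h ∈ 𝓒₃(V)`, and the infimum of `∑ᵢ ‖hᵢ‖_{ρᵢ, μ - ρᵢ}` over all decompositions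
`h = ∑ᵢ hᵢ` with `hᵢ ∈ 𝓒₃(V)` and `0 < ρᵢ < μ` is finite, that is, some decomposition has a finite
sum of norms. -/
def MemC3 (μ : ℝ) (h : Path3 T V) : Prop :=
  IsIncr3 h ∧ ∃ (c : ℕ → Path3 T V) (ρ : ℕ → ℝ),
    (∀ i, IsIncr3 (c i)) ∧ (∀ i, 0 < ρ i ∧ ρ i < μ) ∧
    (∀ i, BddAbove (range (quot3 (ρ i) (μ - ρ i) (c i)))) ∧
    (Summable fun i => ⨆ p, quot3 (ρ i) (μ - ρ i) (c i) p) ∧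
    ∀ s u t, HasSum (fun i => c i s u t) (h s u t)

/-- `L = Λh`, where `Λ` is the sewing map: for some `μ > 1`, `h` lies in `𝓒₃^μ(V)` and `L` is the
element of `𝓒₂^μ(V)` with `δL = h` (there is at most one, and such an `h` satisfies `δh = 0`). -/
def IsSewing (h : Path3 T V) (L : Path2 T V) : Prop :=
  (∃ μ : ℝ, 1 < μ ∧ MemC3 μ h ∧ MemC2 μ L) ∧ delta2 L = h

/-- `δf = (id - Λδ) g`, that is, `δf` is the indefinite integral of the increment `g`. -/
def IsIntegralOf (f : Path1 T V) (g : Path2 T V) : Prop :=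
  ∃ L : Path2 T V, IsSewing (delta2 g) L ∧ ∀ s t, delta1 f s t = g s t - L s t

end Increments

section Rough

variable {T : ℝ} {d m : ℕ}

/-- `x` is a `γ`-Hölder path with a Lévy area `A`: `A ∈ 𝓒₂^{2γ}` and `δA = δx ⊗ δx`. -/
structure IsRoughPath (γ : ℝ) (x : Path1 T (Vec m)) (A : Path2 T (Area m)) : Prop where
  path : MemC1 γ x
  area : MemC2 (2 * γ) A
  chen : ∀ s u t i j, delta2 A s u t (i, j) = delta1 x s u i * delta1 x u t j

/-- The remainder `r_{st} = (δz)_{st} - ζ_s (δx)_{st}`. -/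
def remainder (x : Path1 T (Vec m)) (z : Path1 T (Vec d)) (ζ : Path1 T (Mat d m)) :
    Path2 T (Vec d) :=
  fun s t => delta1 z s t - ζ s (delta1 x s t)

/-- The couple `(z, ζ)` is a weakly controlled path based on `x`, with initial value `a`. -/
structure IsControlled (κ : ℝ) (x : Path1 T (Vec m)) (a : Vec d)
    (z : Path1 T (Vec d)) (ζ : Path1 T (Mat d m)) : Prop where
  path : MemC1 κ z
  initial : ∀ t : Icc (0 : ℝ) T, (t : ℝ) = 0 → z t = a
  derivative : MemC1 κ ζ
  remainder : MemC2 (2 * κ) (remainder x z ζ)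

/-- The natural semi-norm of a controlled path `(z, ζ)`. -/
def controlledNorm (κ : ℝ) (x : Path1 T (Vec m))
    (z : Path1 T (Vec d)) (ζ : Path1 T (Mat d m)) : ℝ :=
  norm2 κ (delta1 z) + supNorm ζ + norm2 κ (delta1 ζ) + norm2 (2 * κ) (remainder x z ζ)

/-- The increment `σ(y) δx + (σ(y))^x · A`, where `(σ(y))^x = Dσ(y) ζ` is the derivative with
respect to `x` of the controlled path `σ(y)`. In coordinates the second term is
`∑_{i,j} (Dσ(y_s)[ζ_s e_i]) e_j A_{st}(i,j)`. -/
def germ (σ : Vec d → Mat d m) (x : Path1 T (Vec m)) (A : Path2 T (Area m))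
    (y : Path1 T (Vec d)) (ζ : Path1 T (Mat d m)) : Path2 T (Vec d) :=
  fun s t => σ (y s) (delta1 x s t) +
    ∑ i : Fin m, ∑ j : Fin m, A s t (i, j) •
      (fderiv ℝ σ (y s) (ζ s (EuclideanSpace.single i 1))) (EuclideanSpace.single j 1)

/-- The controlled path `(y, ζ)` solves `dy = σ(y) dx`, `y_0 = a`: it coincides with the controlled
path `a + ∫ σ(y) dx`, whose derivative with respect to `x` is `σ(y)` and whose increments are
`(id - Λδ)(σ(y) δx + (σ(y))^x · A)`. -/
structure IsSolution (κ : ℝ) (σ : Vec d → Mat d m) (a : Vec d)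
    (x : Path1 T (Vec m)) (A : Path2 T (Area m))
    (y : Path1 T (Vec d)) (ζ : Path1 T (Mat d m)) : Prop where
  controlled : IsControlled κ x a y ζ
  derivative : ∀ t, ζ t = σ (y t)
  equation : IsIntegralOf y (germ σ x A y ζ)

end Rough

end RDE

end

/-!
The proof rests on Davie's description of the solutions. Write
`J_{st} = σ(y_s) (δx)_{st} + F(y_s) A_{st} - (δy)_{st}`, where `F = areaField σ` contracts the bilinear
map `Dσ · σ` with the Lévy area (`eulerRem`). By the definition of `Λ`, a solution is a controlled
path for which `J` is of some order `μ > 1`; conversely, a path for which `J` is of order `3κ` is a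
solution, since `δg` then splits into two increments of orders `(2κ, κ)` and `(κ, 2κ)`
(`memC3_delta2_germ`, `isSolution_of_local`). The sewing map is thus never constructed: only the
uniqueness half of the sewing lemma is used, in the form of the identity
`J_{st} = J_{su} + J_{ut} - defect` (`eulerRem_eq`). With `u` the midpoint of `s` and `t`, a defect
of order `3κ > 1` gives a bound of order `3κ` for `J`, because bisection gains a factor less than one
(`le_of_contraction`, `halves_le`).

* A priori bound (`IsSolution.eulerRem_le`). The defect is of order `3κ` with a constant that is
  *linear* in the bound for `J` (`IsCoeff.norm_defect_le`), and the coefficient of the linear term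
  is small at the scale `smallScale κ B`, an inverse power of the size `B` of the rough path. This
  bounds `J` by a polynomial in `B` on small intervals; as polynomially many of them cover `[0,T]`,
  the bound of the whole norm is polynomial (`IsSolution.controlledNorm_le`).
* Stability (`exists_lipschitz_const`). The same argument, applied to the difference of the
  remainders of two solutions, uses second-order differences of `σ`, `Dσ` and `F`
  (`IsCoeff.norm_defect_sub_le`). On small intervals the difference of the solutions is bounded by
  its supremum and the distance of the data, so that it at most doubles from one interval to the
  next (`norm_sub_le_two_pow`). Uniqueness is the case of equal data.
* Existence (`exists_isSolution`). The Euler schemes `y ↦ y + σ(y) δx + F(y) A` along equidistant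
  grids satisfy the bound for `J` uniformly in the mesh, by strong induction on the number of steps
  (`norm_eulerRem_eulerScheme_le`). They are therefore bounded, and their pointwise limit along an
  ultrafilter inherits the bound.
-/

noncomputable section

namespace RDE

/-! ### Functions with a bounded Lipschitz derivative -/

section Calculus

variable {E G V W : Type*} [NormedAddCommGroup E] [NormedSpace ℝ E]
  [NormedAddCommGroup G] [NormedSpace ℝ G] [NormedAddCommGroup V] [NormedSpace ℝ V]
  [NormedAddCommGroup W] [NormedSpace ℝ W]

/-- `f` is bounded and differentiable, with a bounded Lipschitz derivative; the single constant `B`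
serves for all three bounds. -/
structure BddC11 (B : ℝ) (f : E → G) : Prop where
  differentiable : Differentiable ℝ f
  bound : ∀ v, ‖f v‖ ≤ B
  fderiv_bound : ∀ v, ‖fderiv ℝ f v‖ ≤ B
  fderiv_lipschitz : ∀ v w, ‖fderiv ℝ f v - fderiv ℝ f w‖ ≤ B * ‖v - w‖

theorem norm_sub_le_of_norm_fderiv_le {f : E → G} {B : ℝ} (hf : Differentiable ℝ f)
    (hB : ∀ v, ‖fderiv ℝ f v‖ ≤ B) (v w : E) : ‖f v - f w‖ ≤ B * ‖v - w‖ :=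
  convex_univ.norm_image_sub_le_of_norm_fderiv_le (fun x _ => hf x) (fun x _ => hB x)
    (mem_univ w) (mem_univ v)

namespace BddC11

variable {B : ℝ} {f : E → G}

theorem mono {B' : ℝ} (hf : BddC11 B f) (h : B ≤ B') : BddC11 B' f where
  differentiable := hf.differentiable
  bound v := (hf.bound v).trans h
  fderiv_bound v := (hf.fderiv_bound v).trans h
  fderiv_lipschitz v w := (hf.fderiv_lipschitz v w).trans (by gcongr)

theorem lipschitz (hf : BddC11 B f) (v w : E) : ‖f v - f w‖ ≤ B * ‖v - w‖ :=
  norm_sub_le_of_norm_fderiv_le hf.differentiable hf.fderiv_bound v w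

theorem hasDerivAt_segment (hf : BddC11 B f) (a v : E) (θ : ℝ) :
    HasDerivAt (fun θ : ℝ => f (a + θ • v)) (fderiv ℝ f (a + θ • v) v) θ := by
  have h1 : HasDerivAt (fun θ : ℝ => a + θ • v) v θ := by
    simpa using ((hasDerivAt_id θ).smul_const v).const_add a
  exact (hf.differentiable _).hasFDerivAt.comp_hasDerivAt θ h1

theorem taylor (hB : 0 ≤ B) (hf : BddC11 B f) (a v : E) :
    ‖f (a + v) - f a - fderiv ℝ f a v‖ ≤ B * ‖v‖ ^ 2 := by
  have key := norm_image_sub_le_of_norm_deriv_le_segment_01'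
    (f := fun θ : ℝ => f (a + θ • v) - θ • fderiv ℝ f a v)
    (f' := fun θ => fderiv ℝ f (a + θ • v) v - fderiv ℝ f a v) (C := B * ‖v‖ ^ 2)
    (fun θ _ => by
      refine ((hf.hasDerivAt_segment a v θ).sub ?_).hasDerivWithinAt
      simpa using (hasDerivAt_id θ).smul_const (fderiv ℝ f a v))
    (fun θ hθ => by
      rw [← sub_apply]
      refine (ContinuousLinearMap.le_opNorm _ _).trans ?_
      have h1 := hf.fderiv_lipschitz (a + θ • v) a
      have h2 : ‖a + θ • v - a‖ ≤ ‖v‖ := by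
        rw [add_sub_cancel_left, norm_smul, Real.norm_of_nonneg hθ.1]
        exact mul_le_of_le_one_left (norm_nonneg _) hθ.2.le
      calc _ ≤ (B * ‖v‖) * ‖v‖ := by gcongr; exact h1.trans (by gcongr)
        _ = _ := by ring)
  simpa [sub_right_comm] using key

/-- Second-order differences: the increments of `f` along two vectors `v`, `v'` starting from two
points `a`, `a'`. -/
theorem norm_increment_sub_le (hB : 0 ≤ B) (hf : BddC11 B f) (a a' v v' : E) :
    ‖(f (a + v) - f a) - (f (a' + v') - f a')‖ ≤
      B * (‖a - a'‖ + ‖v - v'‖) * ‖v‖ + B * ‖v - v'‖ := by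
  have key := norm_image_sub_le_of_norm_deriv_le_segment_01'
    (f := fun θ : ℝ => f (a + θ • v) - f (a' + θ • v'))
    (f' := fun θ => fderiv ℝ f (a + θ • v) v - fderiv ℝ f (a' + θ • v') v')
    (C := B * (‖a - a'‖ + ‖v - v'‖) * ‖v‖ + B * ‖v - v'‖)
    (fun θ _ => ((hf.hasDerivAt_segment a v θ).sub
      (hf.hasDerivAt_segment a' v' θ)).hasDerivWithinAt)
    (fun θ hθ => by
      have h1 : fderiv ℝ f (a + θ • v) v - fderiv ℝ f (a' + θ • v') v' =
          (fderiv ℝ f (a + θ • v) - fderiv ℝ f (a' + θ • v')) v +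
            fderiv ℝ f (a' + θ • v') (v - v') := by
        simp
      have h2 : ‖a + θ • v - (a' + θ • v')‖ ≤ ‖a - a'‖ + ‖v - v'‖ := by
        have : a + θ • v - (a' + θ • v') = (a - a') + θ • (v - v') := by
          rw [smul_sub]; abel
        rw [this]
        refine (norm_add_le _ _).trans ?_
        gcongr
        rw [norm_smul, Real.norm_of_nonneg hθ.1]
        exact mul_le_of_le_one_left (norm_nonneg _) hθ.2.le
      rw [h1]
      refine (norm_add_le _ _).trans (add_le_add ?_ ?_)
      · refine (ContinuousLinearMap.le_opNorm _ _).trans ?_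
        gcongr
        exact (hf.fderiv_lipschitz _ _).trans (by gcongr)
      · refine (ContinuousLinearMap.le_opNorm _ _).trans ?_
        gcongr
        exact hf.fderiv_bound _)
  refine le_trans (le_of_eq ?_) key
  simp only [one_smul, zero_smul, add_zero]
  congr 1
  abel

/-- Stability of the first-order Taylor remainder, for a function whose derivative is `C^{1,1}`. -/
theorem norm_taylor_sub_le (hB : 0 ≤ B) (hf : BddC11 B f) (hf' : BddC11 B (fderiv ℝ f))
    (a a' v v' : E) :
    ‖(f (a + v) - f a - fderiv ℝ f a v) - (f (a' + v') - f a' - fderiv ℝ f a' v')‖ ≤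
      (B * (‖a - a'‖ + ‖v - v'‖) * ‖v‖ + B * ‖v - v'‖) * ‖v‖ + B * ‖v'‖ * ‖v - v'‖ := by
  have key := norm_image_sub_le_of_norm_deriv_le_segment_01'
    (f := fun θ : ℝ => (f (a + θ • v) - θ • fderiv ℝ f a v) -
      (f (a' + θ • v') - θ • fderiv ℝ f a' v'))
    (f' := fun θ => (fderiv ℝ f (a + θ • v) v - fderiv ℝ f a v) -
      (fderiv ℝ f (a' + θ • v') v' - fderiv ℝ f a' v'))
    (C := (B * (‖a - a'‖ + ‖v - v'‖) * ‖v‖ + B * ‖v - v'‖) * ‖v‖ + B * ‖v'‖ * ‖v - v'‖)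
    (fun θ _ => by
      refine (((hf.hasDerivAt_segment a v θ).sub ?_).sub
        ((hf.hasDerivAt_segment a' v' θ).sub ?_)).hasDerivWithinAt
      · simpa using (hasDerivAt_id θ).smul_const (fderiv ℝ f a v)
      · simpa using (hasDerivAt_id θ).smul_const (fderiv ℝ f a' v'))
    (fun θ hθ => by
      have scale : ∀ w : E, ‖θ • w‖ ≤ ‖w‖ := fun w => by
        rw [norm_smul, Real.norm_of_nonneg hθ.1]
        exact mul_le_of_le_one_left (norm_nonneg _) hθ.2.le
      have h1 : (fderiv ℝ f (a + θ • v) v - fderiv ℝ f a v) -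
          (fderiv ℝ f (a' + θ • v') v' - fderiv ℝ f a' v') =
          ((fderiv ℝ f (a + θ • v) - fderiv ℝ f a) -
            (fderiv ℝ f (a' + θ • v') - fderiv ℝ f a')) v +
            (fderiv ℝ f (a' + θ • v') - fderiv ℝ f a') (v - v') := by
        simp only [sub_apply, map_sub]
        abel
      rw [h1]
      refine (norm_add_le _ _).trans (add_le_add ?_ ?_)
      · refine (ContinuousLinearMap.le_opNorm _ _).trans ?_
        gcongr
        refine (hf'.norm_increment_sub_le hB a a' (θ • v) (θ • v')).trans ?_
        rw [← smul_sub]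
        gcongr <;> exact scale _
      · refine (ContinuousLinearMap.le_opNorm _ _).trans ?_
        gcongr
        refine (hf.fderiv_lipschitz _ _).trans ?_
        rw [add_sub_cancel_left]
        gcongr
        exact scale _)
  refine le_trans (le_of_eq ?_) key
  simp only [one_smul, zero_smul, add_zero]
  congr 1
  abel

end BddC11

/-- A `C²` function with bounded derivatives up to order two is `C^{1,1}`. -/
theorem exists_bddC11 {f : E → G} (hf : ContDiff ℝ 2 f)
    (hb : ∀ k : ℕ, k ≤ 2 → ∃ M : ℝ, ∀ v, ‖iteratedFDeriv ℝ k f v‖ ≤ M) : ∃ B, BddC11 B f := by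
  obtain ⟨M0, h0⟩ := hb 0 (by norm_num)
  obtain ⟨M1, h1⟩ := hb 1 (by norm_num)
  obtain ⟨M2, h2⟩ := hb 2 (by norm_num)
  simp only [norm_iteratedFDeriv_zero] at h0
  simp only [norm_iteratedFDeriv_one] at h1
  have h2' : ∀ v, ‖fderiv ℝ (fderiv ℝ f) v‖ ≤ M2 := fun v => by
    rw [← norm_iteratedFDeriv_one, norm_iteratedFDeriv_fderiv]
    exact h2 v
  have hd : Differentiable ℝ (fderiv ℝ f) :=
    (hf.fderiv_right (m := 1) (by norm_num)).differentiable (by norm_num)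
  refine ⟨max M0 (max M1 M2), hf.differentiable (by norm_num), fun v => (h0 v).trans (by simp),
    fun v => (h1 v).trans (by simp), fun v w => ?_⟩
  refine (norm_sub_le_of_norm_fderiv_le hd h2' v w).trans ?_
  gcongr
  simp

end Calculus

/-! ### The second-order scheme and its defect -/

section Davie

variable {ι E V W : Type*} [NormedAddCommGroup E] [NormedSpace ℝ E]
  [NormedAddCommGroup V] [NormedSpace ℝ V] [NormedAddCommGroup W] [NormedSpace ℝ W]

theorem norm_apply_sub_apply_le {X Y : Type*} [NormedAddCommGroup X] [NormedSpace ℝ X]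
    [NormedAddCommGroup Y] [NormedSpace ℝ Y] (f f' : X →L[ℝ] Y) (z z' : X) {c d e k : ℝ}
    (hff : ‖f - f'‖ ≤ c) (hz : ‖z‖ ≤ d) (hf' : ‖f'‖ ≤ e) (hzz : ‖z - z'‖ ≤ k) :
    ‖f z - f' z'‖ ≤ c * d + e * k := by
  have : f z - f' z' = (f - f') z + f' (z - z') := by
    simp
  rw [this]
  exact (norm_add_le _ _).trans (add_le_add ((f - f').le_of_opNorm_le_of_le hff hz)
    (f'.le_of_opNorm_le_of_le hf' hzz))

/-- The coefficients of the second-order scheme `a ↦ a + σ(a) p + F(a) P`: the vector fields `σ`,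
their derivative and the second-order coefficient `F` are `C^{1,1}` with the same constant `B`. -/
structure IsCoeff (B : ℝ) (σ : E → V →L[ℝ] E) (F : E → W →L[ℝ] E) : Prop where
  one_le : 1 ≤ B
  field : BddC11 B σ
  deriv : BddC11 B (fderiv ℝ σ)
  area : BddC11 B F

/-- The remainder `J_{st} = σ(y_s) (δx)_{st} + F(y_s) A_{st} - (δy)_{st}` of a path `y` with respect
to the second-order scheme. The index set is arbitrary, so as to cover both paths on `[0,T]` and
sequences on a grid. -/
def eulerRem (σ : E → V →L[ℝ] E) (F : E → W →L[ℝ] E) (x : ι → V) (A : ι → ι → W) (y : ι → E)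
    (s t : ι) : E :=
  σ (y s) (x t - x s) + F (y s) (A s t) - (y t - y s)

/-- The algebraic relation that makes the germ `σ(a) δx + F(a) A` almost additive: `F` applied to
`δA` is `Dσ · σ` applied to `δx ⊗ δx`. -/
def ChenRel (σ : E → V →L[ℝ] E) (F : E → W →L[ℝ] E) (x : ι → V) (A : ι → ι → W) : Prop :=
  ∀ a s u t, F a (A s t) = F a (A s u) + F a (A u t) +
    fderiv ℝ σ a (σ a (x u - x s)) (x t - x u)

/-- The failure of additivity `-(δg)_{sut}` of the germ `g = σ(y) δx + F(y) A`, as a function of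
`a = y_s`, `b = y_u`, `p = (δx)_{su}`, `q = (δx)_{ut}` and `Q = A_{ut}`. -/
def defect (σ : E → V →L[ℝ] E) (F : E → W →L[ℝ] E) (a b : E) (p q : V) (Q : W) : E :=
  (σ b - σ a - fderiv ℝ σ a (σ a p)) q + (F b - F a) Q

variable {σ : E → V →L[ℝ] E} {F : E → W →L[ℝ] E} {B : ℝ}

theorem ChenRel.comp {ι' : Type*} {x : ι → V} {A : ι → ι → W} (h : ChenRel σ F x A)
    (f : ι' → ι) : ChenRel σ F (fun k => x (f k)) (fun k l => A (f k) (f l)) :=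
  fun a s u t => h a (f s) (f u) (f t)

/-- The remainder is additive up to the defect of the germ, because `δδy = 0`. -/
theorem eulerRem_eq {x : ι → V} {A : ι → ι → W} (h : ChenRel σ F x A) (y : ι → E) (s u t : ι) :
    eulerRem σ F x A y s t = eulerRem σ F x A y s u + eulerRem σ F x A y u t -
      defect σ F (y s) (y u) (x u - x s) (x t - x u) (A u t) := by
  have h1 : x t - x s = (x u - x s) + (x t - x u) := by abel
  simp only [eulerRem, defect, h (y s) s u t, h1, map_add, sub_apply]
  abel

theorem eq_of_eulerRem (x : ι → V) (A : ι → ι → W) (y : ι → E) (s t : ι) :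
    y t = y s + (σ (y s) (x t - x s) + F (y s) (A s t) - eulerRem σ F x A y s t) := by
  simp [eulerRem]

namespace IsCoeff

theorem nonneg (hc : IsCoeff B σ F) : 0 ≤ B := zero_le_one.trans hc.one_le

theorem mono {B' : ℝ} (hc : IsCoeff B σ F) (h : B ≤ B') : IsCoeff B' σ F :=
  ⟨hc.one_le.trans h, hc.field.mono h, hc.deriv.mono h, hc.area.mono h⟩

theorem norm_step_le (hc : IsCoeff B σ F) (a : E) {p : V} {P : W} {h : ℝ} (h0 : 0 ≤ h)
    (h1 : h ≤ 1) (hp : ‖p‖ ≤ B * h) (hP : ‖P‖ ≤ B * h ^ 2) :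
    ‖σ a p + F a P‖ ≤ 2 * B ^ 2 * h := by
  have hB := hc.nonneg
  calc ‖σ a p + F a P‖ ≤ ‖σ a‖ * ‖p‖ + ‖F a‖ * ‖P‖ :=
        (norm_add_le _ _).trans (add_le_add (ContinuousLinearMap.le_opNorm _ _)
          (ContinuousLinearMap.le_opNorm _ _))
    _ ≤ B * (B * h) + B * (B * h ^ 2) := by
        gcongr
        · exact hc.field.bound a
        · exact hc.area.bound a
    _ ≤ B * (B * h) + B * (B * h) := by
        gcongr
        exact pow_le_of_le_one h0 h1 (by norm_num)
    _ = _ := by ring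

/-- The defect is of third order, with a constant that is *linear* in the bound `Q` for the
remainder `j`. This is what makes the a priori bounds polynomial; it comes from expanding `σ` at the
point `a + σ(a) p + F(a) P` of the scheme rather than at `b`. -/
theorem norm_defect_le (hc : IsCoeff B σ F) {a b : E} {p q : V} {P Q : W} {j : E} {h N : ℝ}
    (hb : b = a + (σ a p + F a P - j)) (h0 : 0 ≤ h) (h1 : h ≤ 1)
    (hp : ‖p‖ ≤ B * h) (hq : ‖q‖ ≤ B * h) (hP : ‖P‖ ≤ B * h ^ 2) (hQ : ‖Q‖ ≤ B * h ^ 2)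
    (hj : ‖j‖ ≤ N * h ^ 3) (hN : 0 ≤ N) :
    ‖defect σ F a b p q Q‖ ≤ (7 * B ^ 6 + 2 * B ^ 2 * N * h) * h ^ 3 := by
  have hB := hc.nonneg
  have hB1 := hc.one_le
  set w := σ a p + F a P with hw
  have hw2 : ‖w‖ ≤ 2 * B ^ 2 * h := hc.norm_step_le a h0 h1 hp hP
  have e1 : σ b - σ a - fderiv ℝ σ a (σ a p) = (σ b - σ (a + w)) +
      (σ (a + w) - σ a - fderiv ℝ σ a w) + fderiv ℝ σ a (F a P) := by
    rw [hw, map_add]; abel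
  have hbw : ‖b - (a + w)‖ ≤ N * h ^ 3 := by
    have : b - (a + w) = -j := by rw [hb]; abel
    rwa [this, norm_neg]
  have b1 : ‖σ b - σ a - fderiv ℝ σ a (σ a p)‖ ≤ B * (N * h ^ 3) + 5 * B ^ 5 * h ^ 2 := by
    rw [e1]
    have k1 : ‖σ b - σ (a + w)‖ ≤ B * (N * h ^ 3) :=
      (hc.field.lipschitz _ _).trans (by gcongr)
    have k2 : ‖σ (a + w) - σ a - fderiv ℝ σ a w‖ ≤ B * (2 * B ^ 2 * h) ^ 2 :=
      (hc.field.taylor hB a w).trans (by gcongr)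
    have k3 : ‖fderiv ℝ σ a (F a P)‖ ≤ B * (B * (B * h ^ 2)) := by
      refine (ContinuousLinearMap.le_opNorm _ _).trans ?_
      gcongr
      · exact hc.field.fderiv_bound a
      · refine (ContinuousLinearMap.le_opNorm _ _).trans ?_
        gcongr
        exact hc.area.bound a
    have k4 : B * (B * (B * h ^ 2)) ≤ B ^ 5 * h ^ 2 := by
      have : B ^ 3 * h ^ 2 ≤ B ^ 5 * h ^ 2 := by gcongr; norm_num
      linarith
    calc _ ≤ B * (N * h ^ 3) + B * (2 * B ^ 2 * h) ^ 2 + B ^ 5 * h ^ 2 :=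
          (norm_add₃_le).trans (add_le_add (add_le_add k1 k2) (k3.trans k4))
      _ = _ := by ring
  have hba : ‖b - a‖ ≤ 2 * B ^ 2 * h + N * h ^ 3 := by
    have : b - a = w - j := by rw [hb]; abel
    rw [this]
    exact (norm_sub_le _ _).trans (add_le_add hw2 hj)
  calc ‖defect σ F a b p q Q‖
      ≤ ‖σ b - σ a - fderiv ℝ σ a (σ a p)‖ * ‖q‖ + ‖F b - F a‖ * ‖Q‖ :=
        (norm_add_le _ _).trans (add_le_add (ContinuousLinearMap.le_opNorm _ _)
          (ContinuousLinearMap.le_opNorm _ _))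
    _ ≤ (B * (N * h ^ 3) + 5 * B ^ 5 * h ^ 2) * (B * h) +
        (B * (2 * B ^ 2 * h + N * h ^ 3)) * (B * h ^ 2) := by
        gcongr
        exact (hc.area.lipschitz _ _).trans (by gcongr)
    _ = (5 * B ^ 6 + 2 * B ^ 4 + B ^ 2 * N * h + B ^ 2 * N * (h * h)) * h ^ 3 := by ring
    _ ≤ (5 * B ^ 6 + 2 * B ^ 6 + B ^ 2 * N * h + B ^ 2 * N * (h * 1)) * h ^ 3 := by
        gcongr; norm_num
    _ = _ := by ring

set_option maxHeartbeats 800000 in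
/-- Stability of the defect: with the remainders `j`, `j'` of two paths controlled by `N`, the
difference of the defects is of third order and linear in the distance `S` of the data. -/
theorem norm_defect_sub_le (hc : IsCoeff B σ F) {a b a' b' : E} {p q p' q' : V} {P Q P' Q' : W}
    {j j' : E} {h S N : ℝ}
    (hb : b = a + (σ a p + F a P - j)) (hb' : b' = a' + (σ a' p' + F a' P' - j'))
    (h0 : 0 ≤ h) (h1 : h ≤ 1)
    (hp : ‖p‖ ≤ B * h) (hP : ‖P‖ ≤ B * h ^ 2)
    (hq : ‖q‖ ≤ B * h) (hQ : ‖Q‖ ≤ B * h ^ 2) (hj : ‖j‖ ≤ B * h ^ 3)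
    (hp' : ‖p'‖ ≤ B * h) (hP' : ‖P'‖ ≤ B * h ^ 2) (hj' : ‖j'‖ ≤ B * h ^ 3)
    (da : ‖a - a'‖ ≤ S) (dp : ‖p - p'‖ ≤ S * h) (dq : ‖q - q'‖ ≤ S * h)
    (dP : ‖P - P'‖ ≤ S * h ^ 2) (dQ : ‖Q - Q'‖ ≤ S * h ^ 2) (dj : ‖j - j'‖ ≤ N * h ^ 3)
    (hN : 0 ≤ N) :
    ‖defect σ F a b p q Q - defect σ F a' b' p' q' Q'‖ ≤
      120 * B ^ 9 * (S + N * h) * h ^ 3 := by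
  have hB := hc.nonneg
  have hB1 := hc.one_le
  have hS : 0 ≤ S := (norm_nonneg _).trans da
  set v := σ a p + F a P - j with hv
  set v' := σ a' p' + F a' P' - j' with hv'
  have hh2 : h ^ 2 ≤ h := pow_le_of_le_one h0 h1 (by norm_num)
  have hh3 : h ^ 3 ≤ h ^ 2 := pow_le_pow_of_le_one h0 h1 (by norm_num)
  have hBB : B ≤ B ^ 2 := le_self_pow₀ hB1 (by norm_num)
  -- sizes of the increments of the two paths
  have nv : ‖v‖ ≤ 3 * B ^ 2 * h := by
    calc ‖v‖ ≤ 2 * B ^ 2 * h + B * h ^ 3 :=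
          (norm_sub_le _ _).trans (add_le_add (hc.norm_step_le a h0 h1 hp hP) hj)
      _ ≤ 2 * B ^ 2 * h + B ^ 2 * h := by gcongr; exact hh3.trans hh2
      _ = _ := by ring
  have nv' : ‖v'‖ ≤ 3 * B ^ 2 * h := by
    calc ‖v'‖ ≤ 2 * B ^ 2 * h + B * h ^ 3 :=
          (norm_sub_le _ _).trans (add_le_add (hc.norm_step_le a' h0 h1 hp' hP') hj')
      _ ≤ 2 * B ^ 2 * h + B ^ 2 * h := by gcongr; exact hh3.trans hh2
      _ = _ := by ring
  have dF : ‖F a P - F a' P'‖ ≤ 2 * B ^ 2 * S * h ^ 2 := by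
    refine (norm_apply_sub_apply_le (F a) (F a') P P' (c := B * S)
      ((hc.area.lipschitz _ _).trans (by gcongr)) hP (hc.area.bound _) dP).trans ?_
    calc _ = B ^ 2 * S * h ^ 2 + B * S * h ^ 2 := by ring
      _ ≤ B ^ 2 * S * h ^ 2 + B ^ 2 * S * h ^ 2 := by gcongr
      _ = _ := by ring
  have dσ : ‖σ a p - σ a' p'‖ ≤ 2 * B ^ 2 * S * h := by
    refine (norm_apply_sub_apply_le (σ a) (σ a') p p' (c := B * S)
      ((hc.field.lipschitz _ _).trans (by gcongr)) hp (hc.field.bound _) dp).trans ?_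
    calc _ = B ^ 2 * S * h + B * S * h := by ring
      _ ≤ B ^ 2 * S * h + B ^ 2 * S * h := by gcongr
      _ = _ := by ring
  -- the difference of the increments of the two paths is of size `D * h`
  set D := 4 * B ^ 2 * S + N * h with hD
  have hD0 : 0 ≤ D := by positivity
  have dv : ‖v - v'‖ ≤ D * h := by
    have : v - v' = (σ a p - σ a' p') + (F a P - F a' P') - (j - j') := by
      rw [hv, hv']; abel
    rw [this]
    calc _ ≤ 2 * B ^ 2 * S * h + 2 * B ^ 2 * S * h ^ 2 + N * h ^ 3 :=
          (norm_sub_le _ _).trans (add_le_add ((norm_add_le _ _).trans (add_le_add dσ dF)) dj)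
      _ ≤ 2 * B ^ 2 * S * h + 2 * B ^ 2 * S * h + N * h ^ 2 := by gcongr
      _ = _ := by rw [hD]; ring
  have hDS : S + D * h ≤ S + D := by
    have : D * h ≤ D := mul_le_of_le_one_right hD0 h1
    linarith
  have hSD : S + D ≤ 5 * B ^ 2 * (S + N * h) := by
    have : 1 ≤ B ^ 2 := one_le_pow₀ hB1
    rw [hD]
    nlinarith [mul_nonneg hN h0, mul_nonneg (sub_nonneg.2 this) hS,
      mul_nonneg (sub_nonneg.2 this) (mul_nonneg hN h0)]
  have hDD : D ≤ 4 * B ^ 2 * (S + N * h) := by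
    have : 1 ≤ B ^ 2 := one_le_pow₀ hB1
    rw [hD]
    nlinarith [mul_nonneg hN h0, mul_nonneg (sub_nonneg.2 this) (mul_nonneg hN h0)]
  set G := S + N * h with hG
  have hG0 : 0 ≤ G := by positivity
  have hSG : S ≤ G := by rw [hG]; linarith [mul_nonneg hN h0]
  -- second-order differences along the two paths
  have incr : ‖(F b - F a) - (F b' - F a')‖ ≤ 19 * B ^ 5 * G * h := by
    rw [hb, hb']
    refine (hc.area.norm_increment_sub_le hB a a' v v').trans ?_
    calc _ ≤ B * (S + D * h) * (3 * B ^ 2 * h) + B * (D * h) := by gcongr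
      _ ≤ B * (5 * B ^ 2 * G) * (3 * B ^ 2 * h) + B * (4 * B ^ 2 * G * h) := by
          gcongr
          exact hDS.trans hSD
      _ = 15 * B ^ 5 * G * h + 4 * B ^ 3 * G * h := by ring
      _ ≤ 15 * B ^ 5 * G * h + 4 * B ^ 5 * G * h := by gcongr; norm_num
      _ = _ := by ring
  have tayl : ‖(σ b - σ a - fderiv ℝ σ a v) - (σ b' - σ a' - fderiv ℝ σ a' v')‖ ≤
      69 * B ^ 7 * G * h ^ 2 := by
    rw [hb, hb']
    refine (hc.field.norm_taylor_sub_le hB hc.deriv a a' v v').trans ?_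
    calc _ ≤ (B * (S + D * h) * (3 * B ^ 2 * h) + B * (D * h)) * (3 * B ^ 2 * h) +
            B * (3 * B ^ 2 * h) * (D * h) := by gcongr
      _ ≤ (B * (5 * B ^ 2 * G) * (3 * B ^ 2 * h) + B * (4 * B ^ 2 * G * h)) * (3 * B ^ 2 * h) +
            B * (3 * B ^ 2 * h) * (4 * B ^ 2 * G * h) := by
          gcongr
          exact hDS.trans hSD
      _ = 45 * B ^ 7 * G * h ^ 2 + 24 * B ^ 5 * G * h ^ 2 := by ring
      _ ≤ 45 * B ^ 7 * G * h ^ 2 + 24 * B ^ 7 * G * h ^ 2 := by gcongr; norm_num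
      _ = _ := by ring
  have nr : ∀ {a : E} {P : W} {j : E}, ‖P‖ ≤ B * h ^ 2 → ‖j‖ ≤ B * h ^ 3 →
      ‖F a P - j‖ ≤ 2 * B ^ 2 * h ^ 2 := by
    intro a P j hP hj
    calc ‖F a P - j‖ ≤ B * (B * h ^ 2) + B * h ^ 3 := by
          refine (norm_sub_le _ _).trans (add_le_add ?_ hj)
          refine (ContinuousLinearMap.le_opNorm _ _).trans ?_
          gcongr
          exact hc.area.bound a
      _ ≤ B * (B * h ^ 2) + B ^ 2 * h ^ 2 := by gcongr
      _ = _ := by ring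
  have drem : ‖(F a P - j) - (F a' P' - j')‖ ≤ 3 * B ^ 2 * G * h ^ 2 := by
    have : (F a P - j) - (F a' P' - j') = (F a P - F a' P') - (j - j') := by abel
    rw [this]
    calc _ ≤ 2 * B ^ 2 * S * h ^ 2 + N * h ^ 3 := (norm_sub_le _ _).trans (add_le_add dF dj)
      _ = 2 * B ^ 2 * S * h ^ 2 + 1 * (N * h) * h ^ 2 := by ring
      _ ≤ 2 * B ^ 2 * S * h ^ 2 + B ^ 2 * (N * h) * h ^ 2 := by
          gcongr
          exact one_le_pow₀ hB1
      _ ≤ 2 * B ^ 2 * G * h ^ 2 + B ^ 2 * G * h ^ 2 := by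
          gcongr
          rw [hG]; linarith
      _ = _ := by ring
  have dlin : ‖fderiv ℝ σ a (F a P - j) - fderiv ℝ σ a' (F a' P' - j')‖ ≤
      5 * B ^ 3 * G * h ^ 2 := by
    refine (norm_apply_sub_apply_le (fderiv ℝ σ a) (fderiv ℝ σ a') _ _
      (c := B * S) ((hc.field.fderiv_lipschitz _ _).trans (by gcongr)) (nr hP hj)
      (hc.field.fderiv_bound _) drem).trans ?_
    calc _ ≤ B * G * (2 * B ^ 2 * h ^ 2) + B * (3 * B ^ 2 * G * h ^ 2) := by gcongr
      _ = _ := by ring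
  -- the coefficient of `q` in the defect, split into a Taylor remainder and a linear part
  have split : ∀ (a b v : E) (p : V) (P : W) (j : E), v = σ a p + F a P - j →
      σ b - σ a - fderiv ℝ σ a (σ a p) =
        (σ b - σ a - fderiv ℝ σ a v) + fderiv ℝ σ a (F a P - j) := by
    intro a b v p P j h
    rw [h]
    simp only [map_sub, map_add]
    abel
  have dΦ : ‖(σ b - σ a - fderiv ℝ σ a (σ a p)) - (σ b' - σ a' - fderiv ℝ σ a' (σ a' p'))‖ ≤
      74 * B ^ 7 * G * h ^ 2 := by
    rw [split a b v p P j hv, split a' b' v' p' P' j' hv', add_sub_add_comm]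
    calc _ ≤ 69 * B ^ 7 * G * h ^ 2 + 5 * B ^ 3 * G * h ^ 2 :=
          (norm_add_le _ _).trans (add_le_add tayl dlin)
      _ ≤ 69 * B ^ 7 * G * h ^ 2 + 5 * B ^ 7 * G * h ^ 2 := by gcongr; norm_num
      _ = _ := by ring
  have nΦ' : ‖σ b' - σ a' - fderiv ℝ σ a' (σ a' p')‖ ≤ 11 * B ^ 5 * h ^ 2 := by
    rw [split a' b' v' p' P' j' hv']
    have k1 : ‖σ b' - σ a' - fderiv ℝ σ a' v'‖ ≤ B * (3 * B ^ 2 * h) ^ 2 := by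
      rw [hb']
      exact (hc.field.taylor hB a' v').trans (by gcongr)
    have k2 : ‖fderiv ℝ σ a' (F a' P' - j')‖ ≤ B * (2 * B ^ 2 * h ^ 2) := by
      refine (ContinuousLinearMap.le_opNorm _ _).trans ?_
      gcongr
      · exact hc.field.fderiv_bound a'
      · exact nr hP' hj'
    calc _ ≤ B * (3 * B ^ 2 * h) ^ 2 + B * (2 * B ^ 2 * h ^ 2) :=
          (norm_add_le _ _).trans (add_le_add k1 k2)
      _ = 9 * B ^ 5 * h ^ 2 + 2 * B ^ 3 * h ^ 2 := by ring
      _ ≤ 9 * B ^ 5 * h ^ 2 + 2 * B ^ 5 * h ^ 2 := by gcongr; norm_num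
      _ = _ := by ring
  have first := norm_apply_sub_apply_le _ _ q q' dΦ hq nΦ' dq
  have nF' : ‖F b' - F a'‖ ≤ 3 * B ^ 3 * h := by
    refine (hc.area.lipschitz _ _).trans ?_
    rw [hb', add_sub_cancel_left]
    calc _ ≤ B * (3 * B ^ 2 * h) := by gcongr
      _ = _ := by ring
  have second := norm_apply_sub_apply_le _ _ Q Q' incr hQ nF' dQ
  have : defect σ F a b p q Q - defect σ F a' b' p' q' Q' =
      ((σ b - σ a - fderiv ℝ σ a (σ a p)) q - (σ b' - σ a' - fderiv ℝ σ a' (σ a' p')) q') +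
      ((F b - F a) Q - (F b' - F a') Q') := by
    simp only [defect]; abel
  rw [this]
  calc _ ≤ (74 * B ^ 7 * G * h ^ 2 * (B * h) + 11 * B ^ 5 * h ^ 2 * (S * h)) +
        (19 * B ^ 5 * G * h * (B * h ^ 2) + 3 * B ^ 3 * h * (S * h ^ 2)) :=
        (norm_add_le _ _).trans (add_le_add first second)
    _ ≤ (74 * B ^ 7 * G * h ^ 2 * (B * h) + 11 * B ^ 5 * h ^ 2 * (G * h)) +
        (19 * B ^ 5 * G * h * (B * h ^ 2) + 3 * B ^ 3 * h * (G * h ^ 2)) := by gcongr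
    _ = (74 * B ^ 8 + 11 * B ^ 5 + 19 * B ^ 6 + 3 * B ^ 3) * G * h ^ 3 := by ring
    _ ≤ (74 * B ^ 9 + 11 * B ^ 9 + 19 * B ^ 9 + 3 * B ^ 9) * G * h ^ 3 := by
        gcongr <;> norm_num
    _ ≤ 120 * B ^ 9 * G * h ^ 3 := by
        gcongr
        linarith [pow_nonneg hB 9]

end IsCoeff

end Davie

/-! ### The coefficient of the Lévy area -/

section Field

theorem exists_bddC11_bilinear {E X Y U : Type*} [NormedAddCommGroup E] [NormedSpace ℝ E]
    [NormedAddCommGroup X] [NormedSpace ℝ X] [NormedAddCommGroup Y] [NormedSpace ℝ Y]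
    [NormedAddCommGroup U] [NormedSpace ℝ U] (β : Y →L[ℝ] X →L[ℝ] U) {f : E → Y} {g : E → X}
    (hf : ContDiff ℝ 2 f) (hg : ContDiff ℝ 2 g)
    (hfb : ∀ k : ℕ, k ≤ 2 → ∃ M : ℝ, ∀ v, ‖iteratedFDeriv ℝ k f v‖ ≤ M)
    (hgb : ∀ k : ℕ, k ≤ 2 → ∃ M : ℝ, ∀ v, ‖iteratedFDeriv ℝ k g v‖ ≤ M) :
    ∃ B, BddC11 B fun v => β (f v) (g v) := by
  refine exists_bddC11 ((β.contDiff.comp hf).clm_apply hg) fun k hk => ?_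
  choose! M hM using hfb
  choose! M' hM' using hgb
  refine ⟨‖β‖ * ∑ i ∈ Finset.range (k + 1), (k.choose i : ℝ) * M i * M' (k - i), fun v => ?_⟩
  refine (β.norm_iteratedFDeriv_le_of_bilinear hf hg v (by exact_mod_cast hk)).trans ?_
  gcongr with i hi
  · have hi' : i ≤ 2 := by simp at hi; omega
    exact mul_nonneg (Nat.cast_nonneg _) ((norm_nonneg _).trans (hM i hi' v))
  · exact hM i (by simp at hi; omega) v
  · exact hM' (k - i) (by omega) v

theorem exists_bddC11_comp {E X Y Z U : Type*} [NormedAddCommGroup E] [NormedSpace ℝ E]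
    [NormedAddCommGroup X] [NormedSpace ℝ X] [NormedAddCommGroup Y] [NormedSpace ℝ Y]
    [NormedAddCommGroup Z] [NormedSpace ℝ Z] [NormedAddCommGroup U] [NormedSpace ℝ U]
    (L : (X →L[ℝ] Z) →L[ℝ] U) {f : E → Y →L[ℝ] Z} {g : E → X →L[ℝ] Y}
    (hf : ContDiff ℝ 2 f) (hg : ContDiff ℝ 2 g)
    (hfb : ∀ k : ℕ, k ≤ 2 → ∃ M : ℝ, ∀ v, ‖iteratedFDeriv ℝ k f v‖ ≤ M)
    (hgb : ∀ k : ℕ, k ≤ 2 → ∃ M : ℝ, ∀ v, ‖iteratedFDeriv ℝ k g v‖ ≤ M) :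
    ∃ B, BddC11 B fun v => L ((f v).comp (g v)) :=
  exists_bddC11_bilinear ((ContinuousLinearMap.compL ℝ (X →L[ℝ] Y) (X →L[ℝ] Z) U L).comp
    (ContinuousLinearMap.compL ℝ X Y Z)) hf hg hfb hgb

variable {d m : ℕ}

/-- The contraction of a bilinear map with a matrix: `B ↦ (P ↦ ∑ P(i,j) B(e_i, e_j))`. -/
def contract (d m : ℕ) : (Vec m →L[ℝ] Mat d m) →L[ℝ] Area m →L[ℝ] Vec d :=
  LinearMap.toContinuousLinearMap
    { toFun := fun b : Vec m →L[ℝ] Mat d m => ∑ i : Fin m, ∑ j : Fin m,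
        (EuclideanSpace.proj (𝕜 := ℝ) (i, j) : Area m →L[ℝ] ℝ).smulRight
          (b (EuclideanSpace.single i 1) (EuclideanSpace.single j 1))
      map_add' := fun b b' => by
        ext1 P
        simp [smul_add, Finset.sum_add_distrib, sum_apply]
      map_smul' := fun c b => by
        ext1 P
        simp [Finset.smul_sum, smul_comm c, sum_apply] }

theorem contract_apply (b : Vec m →L[ℝ] Mat d m) (P : Area m) :
    contract d m b P = ∑ i : Fin m, ∑ j : Fin m,
      P (i, j) • b (EuclideanSpace.single i 1) (EuclideanSpace.single j 1) := by
  simp [contract, sum_apply]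

theorem vec_eq_sum (p : Vec m) : p = ∑ i : Fin m, p i • EuclideanSpace.single i (1 : ℝ) := by
  ext j
  simp [Finset.sum_apply, Pi.single_apply]

theorem contract_apply_of_eq_mul (b : Vec m →L[ℝ] Mat d m) {P : Area m} {p q : Vec m}
    (h : ∀ i j, P (i, j) = p i * q j) : contract d m b P = b p q := by
  rw [contract_apply]
  conv_rhs => rw [vec_eq_sum p, vec_eq_sum q]
  simp only [map_sum, map_smul, sum_apply, smul_apply, Finset.smul_sum, smul_smul, h]
  rw [Finset.sum_comm]
  simp only [mul_comm]

/-- The coefficient of the Lévy area in the second-order scheme: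
`F(y) P = ∑ P(i,j) (Dσ(y)[σ(y) e_i]) e_j`. -/
def areaField (σ : Vec d → Mat d m) (y : Vec d) : Area m →L[ℝ] Vec d :=
  contract d m ((fderiv ℝ σ y).comp (σ y))

theorem exists_isCoeff {σ : Vec d → Mat d m} (hσ : ContDiff ℝ 3 σ)
    (hσb : ∀ k : ℕ, k ≤ 3 → ∃ M : ℝ, ∀ v, ‖iteratedFDeriv ℝ k σ v‖ ≤ M) :
    ∃ B, IsCoeff B σ (areaField σ) := by
  have hσ' : ContDiff ℝ 2 (fderiv ℝ σ) := hσ.fderiv_right (by norm_num)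
  have hσ2 : ContDiff ℝ 2 σ := hσ.of_le (by norm_num)
  have hb' : ∀ k : ℕ, k ≤ 2 → ∃ M : ℝ, ∀ v, ‖iteratedFDeriv ℝ k (fderiv ℝ σ) v‖ ≤ M :=
    fun k hk => by
      obtain ⟨M, hM⟩ := hσb (k + 1) (by omega)
      exact ⟨M, fun v => by rw [norm_iteratedFDeriv_fderiv]; exact hM v⟩
  have hb : ∀ k : ℕ, k ≤ 2 → ∃ M : ℝ, ∀ v, ‖iteratedFDeriv ℝ k σ v‖ ≤ M :=
    fun k hk => hσb k (by omega)
  obtain ⟨B0, h0⟩ := exists_bddC11 hσ2 hb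
  obtain ⟨B1, h1⟩ := exists_bddC11 hσ' hb'
  obtain ⟨B2, h2⟩ := exists_bddC11_comp (contract d m) hσ' hσ2 hb' hb
  exact ⟨max 1 (max B0 (max B1 B2)), le_max_left _ _, h0.mono (by simp), h1.mono (by simp),
    BddC11.mono h2 (by simp)⟩

end Field

/-! ### Hölder norms -/

section Norms

variable {T : ℝ} {V : Type} [NormedAddCommGroup V] {μ : ℝ} {g : Path2 T V} {f : Path1 T V}

theorem abs_sub_le_length (s t : Icc (0 : ℝ) T) : |(t : ℝ) - s| ≤ T := by
  rw [abs_le]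
  constructor <;> linarith [s.2.1, s.2.2, t.2.1, t.2.2]

theorem norm2_nonneg : 0 ≤ norm2 μ g := Real.iSup_nonneg fun _ => by
  unfold quot2; positivity

theorem supNorm_nonneg : 0 ≤ supNorm f := Real.iSup_nonneg fun _ => norm_nonneg _

theorem norm2_le_holderNorm : norm2 μ (delta1 f) ≤ holderNorm μ f :=
  le_add_of_nonneg_left supNorm_nonneg

theorem supNorm_le {C : ℝ} (hC : 0 ≤ C) (h : ∀ t, ‖f t‖ ≤ C) : supNorm f ≤ C :=
  Real.iSup_le h hC

theorem quot2_le {C : ℝ} (hC : 0 ≤ C) (h : ∀ s t, ‖g s t‖ ≤ C * |(t : ℝ) - s| ^ μ)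
    (p : Icc (0 : ℝ) T × Icc (0 : ℝ) T) : quot2 μ g p ≤ C :=
  div_le_of_le_mul₀ (by positivity) hC (h p.1 p.2)

theorem norm2_le {C : ℝ} (hC : 0 ≤ C) (h : ∀ s t, ‖g s t‖ ≤ C * |(t : ℝ) - s| ^ μ) :
    norm2 μ g ≤ C :=
  Real.iSup_le (quot2_le hC h) hC

theorem bddAbove_quot2 {C : ℝ} (hC : 0 ≤ C) (h : ∀ s t, ‖g s t‖ ≤ C * |(t : ℝ) - s| ^ μ) :
    BddAbove (range (quot2 μ g)) :=
  ⟨C, by rintro _ ⟨p, rfl⟩; exact quot2_le hC h p⟩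

theorem MemC2.norm_le (h : MemC2 μ g) (s t : Icc (0 : ℝ) T) :
    ‖g s t‖ ≤ norm2 μ g * |(t : ℝ) - s| ^ μ := by
  rcases eq_or_ne s t with rfl | hst
  · rw [h.diag, norm_zero]
    exact mul_nonneg norm2_nonneg (by positivity)
  · have : 0 < |(t : ℝ) - s| ^ μ :=
      Real.rpow_pos_of_pos (abs_pos.2 (sub_ne_zero.2 fun h => hst (Subtype.ext h.symm))) _
    rw [← div_le_iff₀ this]
    exact le_ciSup h.bddAbove (s, t)

theorem MemC1.memC2 (h : MemC1 μ f) : MemC2 μ (delta1 f) where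
  continuous := (h.continuous.comp continuous_snd).sub (h.continuous.comp continuous_fst)
  diag _ := sub_self _
  bddAbove := h.bddAbove

theorem MemC1.norm_le (h : MemC1 μ f) (s t : Icc (0 : ℝ) T) :
    ‖f t - f s‖ ≤ norm2 μ (delta1 f) * |(t : ℝ) - s| ^ μ :=
  h.memC2.norm_le s t

theorem rpow_le_rpow_mul_rpow {r ν : ℝ} (hμ : 0 ≤ μ) (hμν : μ ≤ ν) (hr : 0 ≤ r) (hrT : r ≤ T) :
    r ^ ν ≤ T ^ (ν - μ) * r ^ μ := by
  have : r ^ ν = r ^ (ν - μ) * r ^ μ := by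
    rw [← Real.rpow_add_of_nonneg hr (by linarith) hμ, sub_add_cancel]
  rw [this]
  gcongr

theorem bound_of_exponent_le {ν C : ℝ} (hμ : 0 ≤ μ) (hμν : μ ≤ ν) (hC : 0 ≤ C)
    (h : ∀ s t, ‖g s t‖ ≤ C * |(t : ℝ) - s| ^ ν) (s t : Icc (0 : ℝ) T) :
    ‖g s t‖ ≤ C * T ^ (ν - μ) * |(t : ℝ) - s| ^ μ := by
  refine (h s t).trans ?_
  rw [mul_assoc]
  gcongr
  exact rpow_le_rpow_mul_rpow hμ hμν (abs_nonneg _) (abs_sub_le_length s t)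

/-- A continuous increment that is of order `μ` on small intervals is so on all intervals. -/
theorem exists_bound_of_local (hg : Continuous fun p : Icc (0 : ℝ) T × Icc (0 : ℝ) T => g p.1 p.2)
    {τ C : ℝ} (hμ : 0 ≤ μ) (hτ : 0 < τ) (hC : 0 ≤ C)
    (h : ∀ s t : Icc (0 : ℝ) T, |(t : ℝ) - s| ≤ τ → ‖g s t‖ ≤ C * |(t : ℝ) - s| ^ μ) :
    ∃ C', 0 ≤ C' ∧ ∀ s t, ‖g s t‖ ≤ C' * |(t : ℝ) - s| ^ μ := by
  obtain ⟨K, hK⟩ := isCompact_univ.exists_bound_of_continuousOn hg.continuousOn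
  have hK' : ∀ s t, ‖g s t‖ ≤ max K 0 := fun s t => (hK (s, t) (mem_univ _)).trans (le_max_left _ _)
  have hτμ : 0 < τ ^ μ := Real.rpow_pos_of_pos hτ _
  have hKK : 0 ≤ max K 0 / τ ^ μ := div_nonneg (le_max_right _ _) hτμ.le
  refine ⟨C + max K 0 / τ ^ μ, by positivity, fun s t => ?_⟩
  rw [add_mul]
  have h0 : 0 ≤ |(t : ℝ) - s| ^ μ := by positivity
  rcases le_or_gt |(t : ℝ) - s| τ with hst | hst
  · linarith [h s t hst, mul_nonneg hKK h0]
  · have : max K 0 ≤ max K 0 / τ ^ μ * |(t : ℝ) - s| ^ μ := by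
      rw [div_mul_eq_mul_div, le_div_iff₀ hτμ]
      gcongr
    linarith [hK' s t, mul_nonneg hC h0]

end Norms

/-! ### The coboundary of the germ -/

section Solutions

variable {T : ℝ} {d m : ℕ} {κ γ B : ℝ} {σ : Vec d → Mat d m} {x : Path1 T (Vec m)}
  {A : Path2 T (Area m)} {a : Vec d} {y : Path1 T (Vec d)} {ζ : Path1 T (Mat d m)}

theorem rpow_two_mul {r : ℝ} (hr : 0 ≤ r) (κ : ℝ) : r ^ (2 * κ) = (r ^ κ) ^ 2 := by
  rw [mul_comm, Real.rpow_mul hr]; norm_cast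

theorem rpow_three_mul {r : ℝ} (hr : 0 ≤ r) (κ : ℝ) : r ^ (3 * κ) = (r ^ κ) ^ 3 := by
  rw [mul_comm, Real.rpow_mul hr]; norm_cast

theorem IsRoughPath.chenRel (h : IsRoughPath γ x A) : ChenRel σ (areaField σ) x A := by
  intro a s u t
  have h1 := contract_apply_of_eq_mul ((fderiv ℝ σ a).comp (σ a)) (h.chen s u t)
  have h2 : A s t = A s u + A u t + delta2 A s u t := by simp [delta2]
  rw [h2, map_add, map_add]
  congr 1

theorem IsRoughPath.mono (hT : 0 ≤ T) (hκ : 0 ≤ κ) (hκγ : κ ≤ γ) (h : IsRoughPath γ x A) :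
    IsRoughPath κ x A where
  path := ⟨h.path.continuous, bddAbove_quot2 (mul_nonneg norm2_nonneg (by positivity))
    (bound_of_exponent_le hκ hκγ norm2_nonneg h.path.memC2.norm_le)⟩
  area := ⟨h.area.continuous, h.area.diag, bddAbove_quot2 (mul_nonneg norm2_nonneg (by positivity))
    (bound_of_exponent_le (by positivity) (by linarith) norm2_nonneg h.area.norm_le)⟩
  chen := h.chen

theorem germ_eq (hζ : ∀ t, ζ t = σ (y t)) (s t : Icc (0 : ℝ) T) :
    germ σ x A y ζ s t = σ (y s) (x t - x s) + areaField σ (y s) (A s t) := by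
  simp [germ, areaField, contract_apply, delta1, hζ]

theorem eulerRem_eq_germ_sub (hζ : ∀ t, ζ t = σ (y t)) (s t : Icc (0 : ℝ) T) :
    eulerRem σ (areaField σ) x A y s t = germ σ x A y ζ s t - delta1 y s t := by
  rw [germ_eq hζ]; rfl

theorem delta2_germ (hx : IsRoughPath γ x A) (hζ : ∀ t, ζ t = σ (y t)) (s u t : Icc (0 : ℝ) T) :
    delta2 (germ σ x A y ζ) s u t =
      -defect σ (areaField σ) (y s) (y u) (x u - x s) (x t - x u) (A u t) := by
  have h := eulerRem_eq (hx.chenRel (σ := σ)) y s u t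
  simp only [eulerRem_eq_germ_sub hζ, delta1] at h
  simp only [delta2]
  rw [eq_sub_iff_add_eq] at h
  rw [eq_neg_iff_add_eq_zero]
  calc _ = (germ σ x A y ζ s t - (y t - y s) + defect σ (areaField σ) (y s) (y u) (x u - x s)
        (x t - x u) (A u t)) - (germ σ x A y ζ s u - (y u - y s) +
          (germ σ x A y ζ u t - (y t - y u))) := by abel
    _ = 0 := by rw [h, sub_self]

/-- A controlled path whose derivative is `σ(y)` has increments of `σ(y)` that are approximated to
second order by `Dσ(y) σ(y) δx`. -/
theorem IsControlled.norm_field_sub_le (hc : IsCoeff B σ (areaField σ))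
    (h : IsControlled κ x a y ζ) (hζ : ∀ t, ζ t = σ (y t)) (s u : Icc (0 : ℝ) T) :
    ‖σ (y u) - σ (y s) - fderiv ℝ σ (y s) (σ (y s) (x u - x s))‖ ≤
      (B * norm2 κ (delta1 y) ^ 2 + B * norm2 (2 * κ) (RDE.remainder x y ζ)) *
        |(u : ℝ) - s| ^ (2 * κ) := by
  have hB := hc.nonneg
  have h1 := hc.field.taylor hB (y s) (y u - y s)
  have h2 : σ (y u) - σ (y s) - fderiv ℝ σ (y s) (σ (y s) (x u - x s)) =
      (σ (y s + (y u - y s)) - σ (y s) - fderiv ℝ σ (y s) (y u - y s)) +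
        fderiv ℝ σ (y s) (RDE.remainder x y ζ s u) := by
    simp [RDE.remainder, delta1, hζ]
  rw [h2, add_mul]
  refine (norm_add_le _ _).trans (add_le_add (h1.trans ?_) ?_)
  · have := h.path.norm_le s u
    rw [rpow_two_mul (abs_nonneg _), mul_assoc, ← mul_pow]
    gcongr
  · rw [mul_assoc]
    exact ContinuousLinearMap.le_of_opNorm_le_of_le _ (hc.field.fderiv_bound _)
      (h.remainder.norm_le s u)

theorem IsControlled.norm_areaField_sub_le (hc : IsCoeff B σ (areaField σ))
    (h : IsControlled κ x a y ζ) (s u : Icc (0 : ℝ) T) :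
    ‖areaField σ (y u) - areaField σ (y s)‖ ≤
      B * norm2 κ (delta1 y) * |(u : ℝ) - s| ^ κ := by
  have hB := hc.nonneg
  refine (hc.area.lipschitz _ _).trans ?_
  rw [mul_assoc]
  gcongr
  exact h.path.norm_le s u

theorem quot3_le {V : Type} [NormedAddCommGroup V] {h : Path3 T V} {ρ ρ' C : ℝ} (hC : 0 ≤ C)
    (hh : ∀ s u t, ‖h s u t‖ ≤ C * (|(u : ℝ) - s| ^ ρ * |(t : ℝ) - u| ^ ρ')) :
    BddAbove (range (quot3 ρ ρ' h)) :=
  ⟨C, by rintro _ ⟨p, rfl⟩; exact div_le_of_le_mul₀ (by positivity) hC (hh p.1 p.2.1 p.2.2)⟩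

/-- The coboundary of the germ is the sum of an increment of orders `(2κ, κ)`, which comes from
`σ(y) δx`, and one of orders `(κ, 2κ)`, which comes from the Lévy area. -/
theorem memC3_delta2_germ (hκ : 0 < κ) (hc : IsCoeff B σ (areaField σ)) (hx : IsRoughPath κ x A)
    (h : IsControlled κ x a y ζ) (hζ : ∀ t, ζ t = σ (y t)) :
    MemC3 (3 * κ) (delta2 (germ σ x A y ζ)) := by
  have hB := hc.nonneg
  let c₀ : Path3 T (Vec d) := fun s u t =>
    -((σ (y u) - σ (y s) - fderiv ℝ σ (y s) (σ (y s) (x u - x s))) (x t - x u))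
  let c₁ : Path3 T (Vec d) := fun s u t => -((areaField σ (y u) - areaField σ (y s)) (A u t))
  have hsum : ∀ s u t, delta2 (germ σ x A y ζ) s u t = c₀ s u t + c₁ s u t := by
    intro s u t
    rw [delta2_germ hx hζ]
    simp only [defect, c₀, c₁]
    abel
  have cσ := hc.field.differentiable.continuous
  have cdσ := hc.deriv.differentiable.continuous
  have cF := hc.area.differentiable.continuous
  have ys := h.path.continuous.comp
    (continuous_fst (X := Icc (0 : ℝ) T) (Y := Icc (0 : ℝ) T × Icc (0 : ℝ) T))
  have yu := h.path.continuous.comp ((continuous_fst (Y := Icc (0 : ℝ) T)).comp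
    (continuous_snd (X := Icc (0 : ℝ) T)))
  have xsu := hx.path.memC2.continuous.comp ((continuous_fst (X := Icc (0 : ℝ) T)).prodMk
    ((continuous_fst (Y := Icc (0 : ℝ) T)).comp continuous_snd))
  have xut := hx.path.memC2.continuous.comp (continuous_snd (X := Icc (0 : ℝ) T))
  have h₀ : IsIncr3 c₀ := by
    refine ⟨?_, fun s t => ?_, fun s t => ?_⟩
    · exact (((cσ.comp yu).sub (cσ.comp ys)).sub ((cdσ.comp ys).clm_apply
        ((cσ.comp ys).clm_apply xsu))).clm_apply xut |>.neg
    · simp [c₀]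
    · simp [c₀]
  have h₁ : IsIncr3 c₁ := by
    refine ⟨?_, fun s t => ?_, fun s t => ?_⟩
    · exact (((cF.comp yu).sub (cF.comp ys)).clm_apply
        (hx.area.continuous.comp continuous_snd)).neg
    · simp [c₁]
    · simp [c₁, hx.area.diag]
  have hincr : IsIncr3 (delta2 (germ σ x A y ζ)) := by
    refine ⟨?_, fun s t => ?_, fun s t => ?_⟩
    · simp only [hsum]
      exact h₀.continuous.add h₁.continuous
    · rw [hsum, h₀.diag_left, h₁.diag_left, add_zero]
    · rw [hsum, h₀.diag_right, h₁.diag_right, add_zero]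
  have b₀ : BddAbove (range (quot3 (2 * κ) (3 * κ - 2 * κ) c₀)) := by
    refine quot3_le (C := (B * norm2 κ (delta1 y) ^ 2 + B * norm2 (2 * κ) (RDE.remainder x y ζ)) *
      norm2 κ (delta1 x)) ?_ fun s u t => ?_
    · have := norm2_nonneg (μ := κ) (g := delta1 x)
      have := norm2_nonneg (μ := 2 * κ) (g := RDE.remainder x y ζ)
      positivity
    · have e1 := ContinuousLinearMap.le_of_opNorm_le_of_le _ (h.norm_field_sub_le hc hζ s u)
        (hx.path.norm_le u t)
      have e2 : 3 * κ - 2 * κ = κ := by ring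
      simp only [c₀, norm_neg, e2]
      refine e1.trans (le_of_eq (by ring))
  have b₁ : BddAbove (range (quot3 κ (3 * κ - κ) c₁)) := by
    refine quot3_le (C := B * norm2 κ (delta1 y) * norm2 (2 * κ) A) ?_ fun s u t => ?_
    · have := norm2_nonneg (μ := κ) (g := delta1 y)
      have := norm2_nonneg (μ := 2 * κ) (g := A)
      positivity
    · have e1 := ContinuousLinearMap.le_of_opNorm_le_of_le _ (h.norm_areaField_sub_le hc s u)
        (hx.area.norm_le u t)
      have e2 : 3 * κ - κ = 2 * κ := by ring
      simp only [c₁, norm_neg, e2]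
      refine e1.trans (le_of_eq (by ring))
  have zero3 : IsIncr3 (fun _ _ _ => 0 : Path3 T (Vec d)) :=
    ⟨continuous_const, fun _ _ => rfl, fun _ _ => rfl⟩
  have q0 : ∀ p, quot3 κ (3 * κ - κ) (fun _ _ _ => 0 : Path3 T (Vec d)) p = 0 := by
    simp [quot3]
  refine ⟨hincr, fun | 0 => c₀ | 1 => c₁ | _ => fun _ _ _ => 0,
    fun | 0 => 2 * κ | 1 => κ | _ => κ, ?_, ?_, ?_, ?_, ?_⟩
  · rintro (_ | _ | i)
    exacts [h₀, h₁, zero3]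
  · rintro (_ | _ | i) <;> constructor <;> simp only <;> linarith
  · rintro (_ | _ | i)
    · exact b₀
    · exact b₁
    · exact ⟨0, by rintro _ ⟨p, rfl⟩; exact (q0 p).le⟩
  · refine summable_of_ne_finset_zero (s := Finset.range 2) ?_
    rintro (_ | _ | i) hi
    · simp at hi
    · simp at hi
    · simp [q0]
  · intro s u t
    have : delta2 (germ σ x A y ζ) s u t = ∑ i ∈ Finset.range 2,
        (fun (i : ℕ) => (match i with | 0 => c₀ | 1 => c₁ | _ => fun _ _ _ => 0 : Path3 T (Vec d)))
          i s u t := by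
      rw [hsum, Finset.sum_range_succ, Finset.sum_range_one]
      rfl
    rw [this]
    refine hasSum_sum_of_ne_finset_zero ?_
    rintro (_ | _ | i) hi
    · simp at hi
    · simp at hi
    · rfl

end Solutions

/-! ### Bisection and the a priori bound on small intervals -/

section Sewing

/-- If a bound `f ≤ a + N b` always improves to `f ≤ a + λ N b` with `λ < 1`, then `f ≤ a` as soon
as some such bound holds. -/
theorem le_of_contraction {α : Type*} {f a b : α → ℝ} {l C : ℝ} (hl0 : 0 ≤ l) (hl1 : l < 1)
    (hC : 0 ≤ C) (h0 : ∀ p, f p ≤ a p + C * b p)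
    (step : ∀ N, 0 ≤ N → (∀ p, f p ≤ a p + N * b p) → ∀ p, f p ≤ a p + l * N * b p) (p : α) :
    f p ≤ a p := by
  have key : ∀ n : ℕ, ∀ p, f p ≤ a p + l ^ n * C * b p := by
    intro n
    induction n with
    | zero => simpa using h0
    | succ n ih =>
      have := step (l ^ n * C) (by positivity) ih
      intro p
      refine (this p).trans (le_of_eq ?_)
      ring
  have lim : Filter.Tendsto (fun n : ℕ => a p + l ^ n * C * b p) Filter.atTop
      (nhds (a p + 0 * C * b p)) :=
    (((tendsto_pow_atTop_nhds_zero_of_lt_one hl0 hl1).mul_const C).mul_const (b p)).const_add _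
  simpa using ge_of_tendsto' lim fun n => key n p

/-- Subdividing an interval into two parts of at most two thirds of its length gains a factor for
functions of order `θ > 1`. -/
theorem rpow_add_rpow_le {u v θ : ℝ} (hu : 0 ≤ u) (hv : 0 ≤ v) (hθ : 1 ≤ θ)
    (hu' : u ≤ 2 / 3 * (u + v)) (hv' : v ≤ 2 / 3 * (u + v)) :
    u ^ θ + v ^ θ ≤ (2 / 3) ^ (θ - 1) * (u + v) ^ θ := by
  have split : ∀ {r : ℝ}, 0 ≤ r → r ^ θ = r ^ (θ - 1) * r := fun {r} hr => by
    conv_rhs => rw [← Real.rpow_one r, ← Real.rpow_mul hr, one_mul]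
    rw [← Real.rpow_add_of_nonneg hr (by linarith) (by norm_num), sub_add_cancel]
  rw [split hu, split hv, split (add_nonneg hu hv), ← mul_assoc,
    ← Real.mul_rpow (by norm_num) (add_nonneg hu hv), mul_add]
  gcongr

/-- The gain `1 - (2/3)^{3κ-1}` of a subdivision of an interval into two parts of length at most two
thirds, for functions of order `3κ > 1`. -/
def sewGap (κ : ℝ) : ℝ := 1 - (2 / 3 : ℝ) ^ (3 * κ - 1)

theorem sewGap_pos {κ : ℝ} (hκ : 1 / 3 < κ) : 0 < sewGap κ :=
  sub_pos.2 (Real.rpow_lt_one (by norm_num) (by norm_num) (by linarith))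

theorem sewGap_lt_one (κ : ℝ) : sewGap κ < 1 :=
  sub_lt_self _ (Real.rpow_pos_of_pos (by norm_num) _)

theorem rpow_add_rpow_le_sewGap {u v κ : ℝ} (hκ : 1 / 3 < κ) (hu : 0 ≤ u) (hv : 0 ≤ v)
    (hu' : u ≤ 2 / 3 * (u + v)) (hv' : v ≤ 2 / 3 * (u + v)) :
    u ^ (3 * κ) + v ^ (3 * κ) ≤ (1 - sewGap κ) * (u + v) ^ (3 * κ) := by
  rw [sewGap, sub_sub_cancel]
  exact rpow_add_rpow_le hu hv (by linarith) hu' hv'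

variable {T : ℝ}

/-- The midpoint of two times. -/
def mid (s t : Icc (0 : ℝ) T) : Icc (0 : ℝ) T :=
  ⟨((s : ℝ) + t) / 2, by constructor <;> linarith [s.2.1, t.2.1, s.2.2, t.2.2]⟩

theorem abs_mid_sub_left (s t : Icc (0 : ℝ) T) : |(mid s t : ℝ) - s| = |(t : ℝ) - s| / 2 := by
  rw [show |(t : ℝ) - s| / 2 = |((t : ℝ) - s) / 2| by rw [abs_div, abs_two]]
  congr 1
  simp only [mid]; ring

theorem abs_mid_sub_right (s t : Icc (0 : ℝ) T) : |(t : ℝ) - mid s t| = |(t : ℝ) - s| / 2 := by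
  rw [show |(t : ℝ) - s| / 2 = |((t : ℝ) - s) / 2| by rw [abs_div, abs_two]]
  congr 1
  simp only [mid]; ring

theorem rpow_le_rpow_mid_left {κ : ℝ} (hκ : 0 ≤ κ) (s t : Icc (0 : ℝ) T) :
    |(mid s t : ℝ) - s| ^ κ ≤ |(t : ℝ) - s| ^ κ := by
  refine Real.rpow_le_rpow (abs_nonneg _) ?_ hκ
  rw [abs_mid_sub_left]; linarith [abs_nonneg ((t : ℝ) - s)]

theorem rpow_le_rpow_mid_right {κ : ℝ} (hκ : 0 ≤ κ) (s t : Icc (0 : ℝ) T) :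
    |(t : ℝ) - mid s t| ^ κ ≤ |(t : ℝ) - s| ^ κ := by
  refine Real.rpow_le_rpow (abs_nonneg _) ?_ hκ
  rw [abs_mid_sub_right]; linarith [abs_nonneg ((t : ℝ) - s)]

/-- The third-order bounds at the two halves of an interval add up to a smaller one. -/
theorem halves_le {κ : ℝ} (hκ : 1 / 3 < κ) (s t : Icc (0 : ℝ) T) :
    |(mid s t : ℝ) - s| ^ (3 * κ) + |(t : ℝ) - mid s t| ^ (3 * κ) ≤
      (1 - sewGap κ) * |(t : ℝ) - s| ^ (3 * κ) := by
  rw [abs_mid_sub_left, abs_mid_sub_right]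
  have h := rpow_add_rpow_le_sewGap (u := |(t : ℝ) - s| / 2) (v := |(t : ℝ) - s| / 2) hκ
    (by positivity) (by positivity) (by linarith [abs_nonneg ((t : ℝ) - s)])
    (by linarith [abs_nonneg ((t : ℝ) - s)])
  rwa [add_halves] at h

end Sewing

section Apriori

variable {T : ℝ} {d m : ℕ} {κ γ B : ℝ} {σ : Vec d → Mat d m} {x : Path1 T (Vec m)}
  {A : Path2 T (Area m)} {a : Vec d} {y : Path1 T (Vec d)} {ζ : Path1 T (Mat d m)}

/-- The path and the Lévy area are bounded by `B` in the `κ`-Hölder norms. -/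
structure RoughBound (κ B : ℝ) (x : Path1 T (Vec m)) (A : Path2 T (Area m)) : Prop where
  path : ∀ s t, ‖x t - x s‖ ≤ B * |(t : ℝ) - s| ^ κ
  area : ∀ s t, ‖A s t‖ ≤ B * |(t : ℝ) - s| ^ (2 * κ)

theorem RoughBound.path_le (h : RoughBound κ B x A) (hB : 0 ≤ B) {s t : Icc (0 : ℝ) T} {r : ℝ}
    (hr : |(t : ℝ) - s| ^ κ ≤ r) : ‖x t - x s‖ ≤ B * r :=
  (h.path s t).trans (by gcongr)

theorem RoughBound.area_le (h : RoughBound κ B x A) (hB : 0 ≤ B) {s t : Icc (0 : ℝ) T} {r : ℝ}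
    (hr : |(t : ℝ) - s| ^ κ ≤ r) : ‖A s t‖ ≤ B * r ^ 2 :=
  (h.area s t).trans (by rw [rpow_two_mul (abs_nonneg _)]; gcongr)

theorem RoughBound.mono {B' : ℝ} (h : RoughBound κ B x A) (hB : B ≤ B') : RoughBound κ B' x A :=
  ⟨fun s t => (h.path s t).trans (by gcongr), fun s t => (h.area s t).trans (by gcongr)⟩

theorem IsSolution.exists_eulerRem_bound (h : IsSolution κ σ a x A y ζ) :
    ∃ μ C : ℝ, 1 < μ ∧ 0 ≤ C ∧
      ∀ s t, ‖eulerRem σ (areaField σ) x A y s t‖ ≤ C * |(t : ℝ) - s| ^ μ := by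
  obtain ⟨L, ⟨⟨μ, hμ, -, hL⟩, -⟩, heq⟩ := h.equation
  refine ⟨μ, norm2 μ L, hμ, norm2_nonneg, fun s t => ?_⟩
  rw [eulerRem_eq_germ_sub h.derivative, heq, sub_sub_cancel]
  exact hL.norm_le s t

/-- The defect of a controlled path is of order `3κ`. -/
theorem IsControlled.exists_defect_bound (hc : IsCoeff B σ (areaField σ))
    (hx : IsRoughPath κ x A) (h : IsControlled κ x a y ζ) (hζ : ∀ t, ζ t = σ (y t)) :
    ∃ K, 0 ≤ K ∧ ∀ (s u t : Icc (0 : ℝ) T) (r : ℝ), |(u : ℝ) - s| ^ κ ≤ r → |(t : ℝ) - u| ^ κ ≤ r →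
      ‖defect σ (areaField σ) (y s) (y u) (x u - x s) (x t - x u) (A u t)‖ ≤ K * r ^ 3 := by
  have hB := hc.nonneg
  have n1 := norm2_nonneg (μ := κ) (g := delta1 y)
  have n2 := norm2_nonneg (μ := 2 * κ) (g := RDE.remainder x y ζ)
  have n3 := norm2_nonneg (μ := κ) (g := delta1 x)
  have n4 := norm2_nonneg (μ := 2 * κ) (g := A)
  refine ⟨(B * norm2 κ (delta1 y) ^ 2 + B * norm2 (2 * κ) (RDE.remainder x y ζ)) *
    norm2 κ (delta1 x) + B * norm2 κ (delta1 y) * norm2 (2 * κ) A, by positivity,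
    fun s u t r h1 h2 => ?_⟩
  have e1 := ContinuousLinearMap.le_of_opNorm_le_of_le _ (h.norm_field_sub_le hc hζ s u)
    (hx.path.norm_le u t)
  have e2 := ContinuousLinearMap.le_of_opNorm_le_of_le _ (h.norm_areaField_sub_le hc s u)
    (hx.area.norm_le u t)
  rw [rpow_two_mul (abs_nonneg _)] at e1 e2
  have r0 : 0 ≤ r := le_trans (by positivity) h1
  refine (norm_add_le _ _).trans ((add_le_add e1 e2).trans ?_)
  calc _ ≤ (B * norm2 κ (delta1 y) ^ 2 + B * norm2 (2 * κ) (RDE.remainder x y ζ)) * r ^ 2 *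
        (norm2 κ (delta1 x) * r) + B * norm2 κ (delta1 y) * r * (norm2 (2 * κ) A * r ^ 2) := by
        gcongr
    _ = _ := by ring

/-- The remainder of a solution, of order some `μ > 1` by definition, is of order `3κ`. -/
theorem IsSolution.exists_eulerRem_bound_three (hκ : 1 / 3 < κ) (hc : IsCoeff B σ (areaField σ))
    (hx : IsRoughPath κ x A) (h : IsSolution κ σ a x A y ζ) :
    ∃ C, 0 ≤ C ∧
      ∀ s t, ‖eulerRem σ (areaField σ) x A y s t‖ ≤ C * |(t : ℝ) - s| ^ (3 * κ) := by
  obtain ⟨μ, C, hμ, hC, hL⟩ := h.exists_eulerRem_bound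
  obtain ⟨K, hK, hdef⟩ := h.controlled.exists_defect_bound hc hx h.derivative
  have hg := sewGap_pos hκ
  refine ⟨K / sewGap κ, by positivity, fun s t => ?_⟩
  have half1 : (1 / 2 : ℝ) ^ (μ - 1) < 1 :=
    Real.rpow_lt_one (by norm_num) (by norm_num) (by linarith)
  have half2 : ∀ r : ℝ, 0 ≤ r → (r / 2) ^ μ + (r / 2) ^ μ = (1 / 2) ^ (μ - 1) * r ^ μ := by
    intro r hr
    rw [div_eq_mul_one_div, Real.mul_rpow hr (by norm_num), Real.rpow_sub_one (by norm_num)]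
    ring
  refine le_of_contraction (α := Icc (0 : ℝ) T × Icc (0 : ℝ) T)
    (f := fun p => ‖eulerRem σ (areaField σ) x A y p.1 p.2‖)
    (a := fun p => K / sewGap κ * |(p.2 : ℝ) - p.1| ^ (3 * κ))
    (b := fun p => |(p.2 : ℝ) - p.1| ^ μ) (l := (1 / 2 : ℝ) ^ (μ - 1)) (by positivity) half1 hC
    (fun p => (hL p.1 p.2).trans (le_add_of_nonneg_left (by positivity))) ?_ (s, t)
  rintro N hN ih ⟨s, t⟩
  have i1 := ih (s, mid s t)
  have i2 := ih (mid s t, t)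
  have i3 := hdef s (mid s t) t (|(t : ℝ) - s| ^ κ)
    (rpow_le_rpow_mid_left (by linarith) s t) (rpow_le_rpow_mid_right (by linarith) s t)
  rw [← rpow_three_mul (abs_nonneg _)] at i3
  have i4 := halves_le hκ s t
  have i5 := half2 _ (abs_nonneg ((t : ℝ) - s))
  simp only at i1 i2 ⊢
  rw [abs_mid_sub_left] at i1 i4
  rw [abs_mid_sub_right] at i2 i4
  set r := |(t : ℝ) - s| with hr
  have i6 : K / sewGap κ * ((r / 2) ^ (3 * κ) + (r / 2) ^ (3 * κ)) ≤
      K / sewGap κ * ((1 - sewGap κ) * r ^ (3 * κ)) := by gcongr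
  have i7 : K / sewGap κ * ((1 - sewGap κ) * r ^ (3 * κ)) =
      K / sewGap κ * r ^ (3 * κ) - K * r ^ (3 * κ) := by
    field_simp
  have i8 : N * ((r / 2) ^ μ + (r / 2) ^ μ) = (1 / 2) ^ (μ - 1) * N * r ^ μ := by
    rw [i5]; ring
  rw [eulerRem_eq (hx.chenRel (σ := σ)) y s (mid s t) t]
  have i9 := (norm_sub_le (eulerRem σ (areaField σ) x A y s (mid s t) +
    eulerRem σ (areaField σ) x A y (mid s t) t) (defect σ (areaField σ) (y s) (y (mid s t))
      (x (mid s t) - x s) (x t - x (mid s t)) (A (mid s t) t))).trans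
    (add_le_add (norm_add_le _ _) le_rfl)
  linarith

/-- The scale, measured by `ε = τ^κ`, below which the scheme contracts. -/
def smallScale (κ B : ℝ) : ℝ := sewGap κ / (4 * B ^ 2)

/-- The a priori constant for the remainder of a solution on small intervals. -/
def remConst (κ B : ℝ) : ℝ := 14 * B ^ 6 / sewGap κ

theorem smallScale_pos (hκ : 1 / 3 < κ) (hB : 1 ≤ B) : 0 < smallScale κ B := by
  have := sewGap_pos hκ
  unfold smallScale; positivity

theorem smallScale_le_one (hB : 1 ≤ B) : smallScale κ B ≤ 1 := by
  have : 1 ≤ B ^ 2 := one_le_pow₀ hB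
  rw [smallScale, div_le_one (by positivity)]
  linarith [sewGap_lt_one κ]

theorem remConst_pos (hκ : 1 / 3 < κ) (hB : 1 ≤ B) : 0 < remConst κ B := by
  have := sewGap_pos hκ
  unfold remConst; positivity

theorem two_mul_smallScale (hB : 1 ≤ B) : 2 * B ^ 2 * smallScale κ B = sewGap κ / 2 := by
  unfold smallScale; field_simp; ring

theorem remConst_mul_sewGap (hκ : 1 / 3 < κ) : remConst κ B * sewGap κ = 14 * B ^ 6 := by
  have := (sewGap_pos hκ).ne'
  unfold remConst; field_simp

/-- A priori bound on small intervals: the remainder of a solution is bounded by a constant that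
depends only on the bound `B` for the coefficients and the rough path. -/
theorem IsSolution.eulerRem_le (hκ : 1 / 3 < κ) (hc : IsCoeff B σ (areaField σ))
    (hx : IsRoughPath κ x A) (hb : RoughBound κ B x A) (h : IsSolution κ σ a x A y ζ)
    {s t : Icc (0 : ℝ) T} (hst : |(t : ℝ) - s| ^ κ ≤ smallScale κ B) :
    ‖eulerRem σ (areaField σ) x A y s t‖ ≤ remConst κ B * |(t : ℝ) - s| ^ (3 * κ) := by
  obtain ⟨C, hC, hL⟩ := h.exists_eulerRem_bound_three hκ hc hx
  have hB := hc.nonneg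
  have hB1 := hc.one_le
  have hg := sewGap_pos hκ
  have hg1 := sewGap_lt_one κ
  have hε0 := smallScale_pos hκ hB1
  have hε1 := smallScale_le_one (κ := κ) hB1
  have hQ := remConst_pos hκ hB1
  refine le_of_contraction
    (α := {p : Icc (0 : ℝ) T × Icc (0 : ℝ) T // |(p.2 : ℝ) - p.1| ^ κ ≤ smallScale κ B})
    (f := fun p => ‖eulerRem σ (areaField σ) x A y p.1.1 p.1.2‖)
    (a := fun p => remConst κ B * |(p.1.2 : ℝ) - p.1.1| ^ (3 * κ))
    (b := fun p => |(p.1.2 : ℝ) - p.1.1| ^ (3 * κ)) (l := 1 - sewGap κ / 2) (by linarith)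
    (by linarith) hC
    (fun p => (hL _ _).trans (le_add_of_nonneg_left (by positivity))) ?_ ⟨(s, t), hst⟩
  rintro N hN ih ⟨⟨s, t⟩, hst⟩
  have hl : |(mid s t : ℝ) - s| ^ κ ≤ |(t : ℝ) - s| ^ κ :=
    rpow_le_rpow_mid_left (by linarith) s t
  have hr : |(t : ℝ) - mid s t| ^ κ ≤ |(t : ℝ) - s| ^ κ :=
    rpow_le_rpow_mid_right (by linarith) s t
  have i1 := ih ⟨(s, mid s t), hl.trans hst⟩
  have i2 := ih ⟨(mid s t, t), hr.trans hst⟩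
  simp only [← add_mul] at i1 i2 hst ⊢
  have hh0 : 0 ≤ |(t : ℝ) - s| ^ κ := by positivity
  have i3 := hc.norm_defect_le (h := |(t : ℝ) - s| ^ κ) (N := remConst κ B + N)
    (eq_of_eulerRem (σ := σ) (F := areaField σ) x A y s (mid s t)) hh0 (hst.trans hε1)
    (hb.path_le hB hl) (hb.path_le hB hr) (hb.area_le hB hl) (hb.area_le hB hr)
    (i1.trans (by rw [rpow_three_mul (abs_nonneg _)]; gcongr)) (by positivity)
  have i4 := halves_le hκ s t
  rw [eulerRem_eq (hx.chenRel (σ := σ)) y s (mid s t) t]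
  have i9 := (norm_sub_le (eulerRem σ (areaField σ) x A y s (mid s t) +
    eulerRem σ (areaField σ) x A y (mid s t) t) (defect σ (areaField σ) (y s) (y (mid s t))
      (x (mid s t) - x s) (x t - x (mid s t)) (A (mid s t) t))).trans
    (add_le_add (norm_add_le _ _) le_rfl)
  have i5 : 7 * B ^ 6 + 2 * B ^ 2 * (remConst κ B + N) * |(t : ℝ) - s| ^ κ ≤
      remConst κ B * sewGap κ / 2 + (remConst κ B + N) * (sewGap κ / 2) := by
    have e1 : 2 * B ^ 2 * (remConst κ B + N) * |(t : ℝ) - s| ^ κ ≤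
        2 * B ^ 2 * (remConst κ B + N) * smallScale κ B := by gcongr
    have e2 : 2 * B ^ 2 * (remConst κ B + N) * smallScale κ B =
        (remConst κ B + N) * (sewGap κ / 2) := by
      rw [← two_mul_smallScale hB1]; ring
    have e3 := remConst_mul_sewGap (B := B) hκ
    linarith
  rw [← rpow_three_mul (abs_nonneg _)] at i3
  have hh3 : 0 ≤ |(t : ℝ) - s| ^ (3 * κ) := by positivity
  have i6 := mul_le_mul_of_nonneg_right i5 hh3
  have i7 := mul_le_mul_of_nonneg_left i4 (by positivity : 0 ≤ remConst κ B + N)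
  calc _ ≤ _ := i9
    _ ≤ (remConst κ B + N) * ((1 - sewGap κ) * |(t : ℝ) - s| ^ (3 * κ)) +
        (remConst κ B * sewGap κ / 2 + (remConst κ B + N) * (sewGap κ / 2)) *
          |(t : ℝ) - s| ^ (3 * κ) := by linarith
    _ = _ := by ring

end Apriori

/-! ### Global a priori bounds -/

section Global

variable {T : ℝ} {d m : ℕ} {κ γ B : ℝ} {σ : Vec d → Mat d m} {x : Path1 T (Vec m)}
  {A : Path2 T (Area m)} {a : Vec d} {y : Path1 T (Vec d)} {ζ : Path1 T (Mat d m)}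

/-- Chaining: a path with increments at most `C` over times `τ` has increments at most `n C` if
`T ≤ n τ`. -/
theorem norm_sub_le_of_chain {V : Type*} [NormedAddCommGroup V] {f : Icc (0 : ℝ) T → V} {τ C : ℝ}
    {n : ℕ} (hn : 0 < n) (hT : T ≤ n * τ)
    (h : ∀ s t : Icc (0 : ℝ) T, |(t : ℝ) - s| ≤ τ → ‖f t - f s‖ ≤ C) (s t : Icc (0 : ℝ) T) :
    ‖f t - f s‖ ≤ n * C := by
  have hn' : (0 : ℝ) < n := by exact_mod_cast hn
  let p : ℕ → Icc (0 : ℝ) T := fun k =>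
    projIcc 0 T (s.2.1.trans s.2.2) (s + (k / n : ℝ) * ((t : ℝ) - s))
  have p0 : p 0 = s := by simp [p]
  have pn : p n = t := by simp [p, hn'.ne']
  have step : ∀ k, |(p (k + 1) : ℝ) - p k| ≤ τ := by
    intro k
    have h1 := abs_projIcc_sub_projIcc (c := (s + ((k + 1 : ℕ) / n : ℝ) * ((t : ℝ) - s) : ℝ))
      (d := (s + (k / n : ℝ) * ((t : ℝ) - s) : ℝ)) (s.2.1.trans s.2.2)
    refine h1.trans ?_
    have h2 : (s + ((k + 1 : ℕ) / n : ℝ) * ((t : ℝ) - s) : ℝ) -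
        (s + (k / n : ℝ) * ((t : ℝ) - s) : ℝ) = ((t : ℝ) - s) / n := by
      push_cast; ring
    rw [h2, abs_div, abs_of_pos hn', div_le_iff₀ hn', mul_comm]
    exact (abs_sub_le_length s t).trans hT
  have key : ∀ k : ℕ, ‖f (p k) - f s‖ ≤ k * C := by
    intro k
    induction k with
    | zero => simp [p0]
    | succ k ih =>
      have : f (p (k + 1)) - f s = (f (p (k + 1)) - f (p k)) + (f (p k) - f s) := by abel
      rw [this]
      push_cast
      linarith [norm_add_le (f (p (k + 1)) - f (p k)) (f (p k) - f s), h _ _ (step k)]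
  simpa [pn] using key n

/-- The number of intervals of length `ε^{1/κ}` needed to cover `[0,T]`. -/
def coverNum (κ T ε : ℝ) : ℕ := ⌊T / ε ^ (1 / κ)⌋₊ + 1

theorem rpow_le_iff_le_scale {κ ε r : ℝ} (hκ : 0 < κ) (hε : 0 < ε) (hr : 0 ≤ r) :
    r ^ κ ≤ ε ↔ r ≤ ε ^ (1 / κ) := by
  rw [one_div, Real.le_rpow_inv_iff_of_pos hr hε.le hκ]

theorem le_coverNum {κ ε : ℝ} (hε : 0 < ε) (T : ℝ) : T ≤ coverNum κ T ε * ε ^ (1 / κ) := by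
  have : 0 < ε ^ (1 / κ) := Real.rpow_pos_of_pos hε _
  rw [← div_le_iff₀ this, coverNum]
  push_cast
  exact (Nat.lt_floor_add_one _).le

theorem coverNum_le {κ ε : ℝ} (hκ : 1 / 3 < κ) (hT : 0 ≤ T) (hε : 0 < ε) (hε1 : ε ≤ 1) :
    (coverNum κ T ε : ℝ) ≤ (T + 1) * (1 / ε) ^ 3 := by
  have h1 : 0 < ε ^ (1 / κ) := Real.rpow_pos_of_pos hε _
  have h2 : ε ^ 3 ≤ ε ^ (1 / κ) := by
    rw [← Real.rpow_natCast]
    refine Real.rpow_le_rpow_of_exponent_ge hε hε1 ?_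
    rw [div_le_iff₀ (by linarith)]
    push_cast; linarith
  have h3 : T / ε ^ (1 / κ) ≤ T * (1 / ε) ^ 3 := by
    rw [div_eq_mul_one_div, one_div_pow]
    gcongr
  have h4 : 1 ≤ (1 / ε) ^ 3 := one_le_pow₀ (by rwa [one_le_div hε])
  rw [coverNum]
  push_cast
  linarith [Nat.floor_le (div_nonneg hT h1.le)]

theorem norm_sub_le_of_eulerRem (hc : IsCoeff B σ (areaField σ)) (hb : RoughBound κ B x A)
    {s t : Icc (0 : ℝ) T} {N : ℝ} (hN : 0 ≤ N) (h1 : |(t : ℝ) - s| ^ κ ≤ 1)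
    (h : ‖eulerRem σ (areaField σ) x A y s t‖ ≤ N * |(t : ℝ) - s| ^ (3 * κ)) :
    ‖y t - y s‖ ≤ (2 * B ^ 2 + N) * |(t : ℝ) - s| ^ κ := by
  have hB := hc.nonneg
  have h0 : 0 ≤ |(t : ℝ) - s| ^ κ := by positivity
  have e : y t - y s = (σ (y s) (x t - x s) + areaField σ (y s) (A s t)) -
      eulerRem σ (areaField σ) x A y s t := by
    simp [eulerRem]
  rw [e, add_mul]
  refine (norm_sub_le _ _).trans (add_le_add
    (hc.norm_step_le _ h0 h1 (hb.path_le hB le_rfl) (hb.area_le hB le_rfl)) (h.trans ?_))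
  rw [rpow_three_mul (abs_nonneg _)]
  gcongr
  exact pow_le_of_le_one h0 h1 (by norm_num)

/-- The global Hölder constant of a solution. -/
def pathConst (κ T B : ℝ) : ℝ :=
  coverNum κ T (smallScale κ B) * (2 * B ^ 2 + remConst κ B)

theorem pathConst_nonneg (hκ : 1 / 3 < κ) (hB : 1 ≤ B) : 0 ≤ pathConst κ T B := by
  have := remConst_pos hκ hB
  unfold pathConst; positivity

theorem IsSolution.norm_increment_le (hκ : 1 / 3 < κ) (hc : IsCoeff B σ (areaField σ))
    (hx : IsRoughPath κ x A) (hb : RoughBound κ B x A) (h : IsSolution κ σ a x A y ζ)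
    (s t : Icc (0 : ℝ) T) : ‖y t - y s‖ ≤ pathConst κ T B * |(t : ℝ) - s| ^ κ := by
  have hB1 := hc.one_le
  have hQ := remConst_pos hκ hB1
  have hε0 := smallScale_pos hκ hB1
  have hε1 := smallScale_le_one (κ := κ) hB1
  set ε := smallScale κ B with hε
  have loc : ∀ s t : Icc (0 : ℝ) T, |(t : ℝ) - s| ^ κ ≤ ε →
      ‖y t - y s‖ ≤ (2 * B ^ 2 + remConst κ B) * |(t : ℝ) - s| ^ κ := fun s t hst =>
    norm_sub_le_of_eulerRem hc hb hQ.le (hst.trans hε1) (h.eulerRem_le hκ hc hx hb hst)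
  have glob := norm_sub_le_of_chain (f := y) (n := coverNum κ T ε) (by simp [coverNum])
    (le_coverNum (κ := κ) hε0 T) (C := (2 * B ^ 2 + remConst κ B) * ε) (fun s t hst => by
      have := (rpow_le_iff_le_scale (by linarith) hε0 (abs_nonneg _)).2 hst
      exact (loc s t this).trans (by gcongr)) s t
  have hn : (1 : ℝ) ≤ coverNum κ T ε := by simp [coverNum]
  rw [pathConst, ← hε]
  rcases le_or_gt (|(t : ℝ) - s| ^ κ) ε with hst | hst
  · refine (loc s t hst).trans ?_
    gcongr
    exact le_mul_of_one_le_left (by positivity) hn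
  · refine glob.trans ?_
    rw [mul_assoc]
    gcongr

theorem IsSolution.norm_remainder_le (hκ : 1 / 3 < κ) (hc : IsCoeff B σ (areaField σ))
    (hx : IsRoughPath κ x A) (hb : RoughBound κ B x A) (hs : IsSolution κ σ a x A y ζ)
    (s t : Icc (0 : ℝ) T) : ‖remainder x y ζ s t‖ ≤
      (pathConst κ T B + B ^ 2 + remConst κ B) / smallScale κ B * |(t : ℝ) - s| ^ (2 * κ) := by
  have hB := hc.nonneg
  have hB1 := hc.one_le
  have hQ := remConst_pos hκ hB1
  have hε0 := smallScale_pos hκ hB1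
  have hε1 := smallScale_le_one (κ := κ) hB1
  have hD := pathConst_nonneg (T := T) hκ hB1
  set ε := smallScale κ B with hε
  set h := |(t : ℝ) - s| ^ κ with hh
  have h0 : 0 ≤ h := by positivity
  rw [rpow_two_mul (abs_nonneg _), ← hh]
  rcases le_or_gt h ε with hst | hst
  · have e : remainder x y ζ s t = areaField σ (y s) (A s t) -
        eulerRem σ (areaField σ) x A y s t := by
      simp only [remainder, delta1, eulerRem, hs.derivative]
      abel
    have e1 : ‖areaField σ (y s) (A s t)‖ ≤ B * (B * h ^ 2) :=
      ContinuousLinearMap.le_of_opNorm_le_of_le _ (hc.area.bound _) (hb.area_le hB le_rfl)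
    have e2 := hs.eulerRem_le hκ hc hx hb hst
    rw [rpow_three_mul (abs_nonneg _), ← hh] at e2
    have e3 : h ^ 3 ≤ h ^ 2 := pow_le_pow_of_le_one h0 (hst.trans hε1) (by norm_num)
    rw [e]
    calc _ ≤ B * (B * h ^ 2) + remConst κ B * h ^ 2 :=
          (norm_sub_le _ _).trans (add_le_add e1 (e2.trans (by gcongr)))
      _ = (0 + B ^ 2 + remConst κ B) * h ^ 2 := by ring
      _ ≤ (pathConst κ T B + B ^ 2 + remConst κ B) / ε * h ^ 2 := by
          gcongr
          refine le_trans ?_ (le_div_self (by positivity) hε0 hε1)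
          gcongr
  · have e1 : ‖ζ s (delta1 x s t)‖ ≤ B * (B * h) := by
      rw [hs.derivative]
      exact ContinuousLinearMap.le_of_opNorm_le_of_le _ (hc.field.bound _) (hb.path_le hB le_rfl)
    have e2 := hs.norm_increment_le hκ hc hx hb s t
    calc _ ≤ pathConst κ T B * h + B * (B * h) :=
          (norm_sub_le _ _).trans (add_le_add e2 e1)
      _ = (pathConst κ T B + B ^ 2 + 0) * h := by ring
      _ ≤ (pathConst κ T B + B ^ 2 + remConst κ B) * h := by gcongr
      _ ≤ (pathConst κ T B + B ^ 2 + remConst κ B) * (h * (h / ε)) := by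
          gcongr
          exact le_mul_of_one_le_right h0 ((one_le_div hε0).2 hst.le)
      _ = _ := by ring

/-- The constant of the polynomial a priori bound. -/
def polyConst (κ T : ℝ) : ℝ :=
  2 * (1024 * (T + 1) / sewGap κ ^ 4) + 1 +
    (1024 * (T + 1) / sewGap κ ^ 4 + 1 + 14 / sewGap κ) * (4 / sewGap κ)

theorem pathConst_le (hκ : 1 / 3 < κ) (hT : 0 ≤ T) (hB : 1 ≤ B) :
    pathConst κ T B ≤ 1024 * (T + 1) / sewGap κ ^ 4 * B ^ 12 := by
  have hg := sewGap_pos hκ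
  have hg1 := sewGap_lt_one κ
  have hQ := remConst_pos hκ hB
  have h1 := coverNum_le hκ hT (smallScale_pos hκ hB) (smallScale_le_one hB)
  have h2 : 1 / smallScale κ B = 4 * B ^ 2 / sewGap κ := by
    rw [smallScale, one_div_div]
  have h3 : 2 * B ^ 2 + remConst κ B ≤ 16 * B ^ 6 / sewGap κ := by
    have e1 : 2 * B ^ 2 ≤ 2 * B ^ 6 / sewGap κ := by
      refine le_trans ?_ (le_div_self (by positivity) hg hg1.le)
      gcongr; norm_num
    rw [remConst]
    calc _ ≤ 2 * B ^ 6 / sewGap κ + 14 * B ^ 6 / sewGap κ := by gcongr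
      _ = _ := by ring
  rw [h2] at h1
  calc pathConst κ T B ≤ ((T + 1) * (4 * B ^ 2 / sewGap κ) ^ 3) * (16 * B ^ 6 / sewGap κ) := by
        unfold pathConst
        gcongr
    _ = _ := by field_simp; ring

/-- The a priori bound for the norm of a solution, polynomial in the bound `B` of the rough path. -/
theorem IsSolution.controlledNorm_le (hκ : 1 / 3 < κ) (hT : 0 ≤ T)
    (hc : IsCoeff B σ (areaField σ)) (hx : IsRoughPath κ x A) (hb : RoughBound κ B x A)
    (h : IsSolution κ σ a x A y ζ) : controlledNorm κ x y ζ ≤ polyConst κ T * B ^ 14 := by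
  have hB := hc.nonneg
  have hB1 := hc.one_le
  have hg := sewGap_pos hκ
  have hQ := remConst_pos hκ hB1
  have hD := pathConst_nonneg (T := T) hκ hB1
  have hε := smallScale_pos hκ hB1
  set P := 1024 * (T + 1) / sewGap κ ^ 4 with hP
  have hP0 : 0 ≤ P := by positivity
  have hDP : pathConst κ T B ≤ P * B ^ 12 := pathConst_le hκ hT hB1
  have b1 : norm2 κ (delta1 y) ≤ P * B ^ 14 :=
    (norm2_le hD (h.norm_increment_le hκ hc hx hb)).trans (hDP.trans (by gcongr; norm_num))
  have b2 : supNorm ζ ≤ B ^ 14 :=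
    (supNorm_le hB fun t => by rw [h.derivative]; exact hc.field.bound _).trans
      (le_self_pow₀ hB1 (by norm_num))
  have b3 : norm2 κ (delta1 ζ) ≤ P * B ^ 14 := by
    have : norm2 κ (delta1 ζ) ≤ B * pathConst κ T B := norm2_le (by positivity) fun s t => by
      simp only [delta1, h.derivative]
      refine (hc.field.lipschitz _ _).trans ?_
      rw [mul_assoc]
      gcongr
      exact h.norm_increment_le hκ hc hx hb s t
    calc _ ≤ B * (P * B ^ 12) := this.trans (by gcongr)
      _ = P * B ^ 13 := by ring
      _ ≤ P * B ^ 14 := by gcongr; norm_num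
  have b4 : norm2 (2 * κ) (remainder x y ζ) ≤ (P + 1 + 14 / sewGap κ) * (4 / sewGap κ) * B ^ 14 := by
    refine (norm2_le (by positivity) (h.norm_remainder_le hκ hc hx hb)).trans ?_
    have e : (pathConst κ T B + B ^ 2 + remConst κ B) ≤
        P * B ^ 12 + B ^ 12 + 14 * B ^ 12 / sewGap κ := by
      unfold remConst
      gcongr <;> norm_num
    calc _ ≤ (P * B ^ 12 + B ^ 12 + 14 * B ^ 12 / sewGap κ) / smallScale κ B := by gcongr
      _ = _ := by unfold smallScale; field_simp
  unfold controlledNorm polyConst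
  rw [← hP]
  calc _ ≤ P * B ^ 14 + B ^ 14 + P * B ^ 14 +
        (P + 1 + 14 / sewGap κ) * (4 / sewGap κ) * B ^ 14 :=
        add_le_add (add_le_add (add_le_add b1 b2) b3) b4
    _ = _ := by ring

end Global

/-! ### Differences of two solutions -/

section Stability

variable {T : ℝ} {d m : ℕ} {κ γ B S D : ℝ} {σ : Vec d → Mat d m} {x x' : Path1 T (Vec m)}
  {A A' : Path2 T (Area m)} {a a' : Vec d} {y y' : Path1 T (Vec d)} {ζ ζ' : Path1 T (Mat d m)}

/-- The difference of the germs of two paths. -/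
theorem IsCoeff.norm_step_sub_le (hc : IsCoeff B σ (areaField σ)) {a a' : Vec d} {p p' : Vec m}
    {P P' : Area m} {r r' : ℝ} (da : ‖a - a'‖ ≤ S) (hp : ‖p‖ ≤ B * r) (hP : ‖P‖ ≤ B * r')
    (dp : ‖p - p'‖ ≤ S * r) (dP : ‖P - P'‖ ≤ S * r') (hr : 0 ≤ r) (hr' : 0 ≤ r') :
    ‖(σ a p + areaField σ a P) - (σ a' p' + areaField σ a' P')‖ ≤
      2 * B ^ 2 * S * (r + r') := by
  have hB := hc.nonneg
  have hB1 := hc.one_le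
  have hS : 0 ≤ S := (norm_nonneg _).trans da
  have hBB : B ≤ B ^ 2 := le_self_pow₀ hB1 (by norm_num)
  have e1 := norm_apply_sub_apply_le (σ a) (σ a') p p' (c := B * S)
    ((hc.field.lipschitz _ _).trans (by gcongr)) hp (hc.field.bound _) dp
  have e2 := norm_apply_sub_apply_le (areaField σ a) (areaField σ a') P P' (c := B * S)
    ((hc.area.lipschitz _ _).trans (by gcongr)) hP (hc.area.bound _) dP
  rw [add_sub_add_comm]
  calc _ ≤ (B * S * (B * r) + B * (S * r)) + (B * S * (B * r') + B * (S * r')) :=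
        (norm_add_le _ _).trans (add_le_add e1 e2)
    _ = B ^ 2 * S * (r + r') + B * (S * (r + r')) := by ring
    _ ≤ B ^ 2 * S * (r + r') + B ^ 2 * (S * (r + r')) := by gcongr
    _ = _ := by ring

/-- The scale on which the difference of two solutions is controlled by its supremum. -/
def diffScale (κ B : ℝ) : ℝ := sewGap κ / (240 * B ^ 9)

/-- The Lipschitz constant of the remainder on small intervals. -/
def diffConst (κ B : ℝ) : ℝ := 240 * B ^ 9 / sewGap κ

theorem diffScale_pos (hκ : 1 / 3 < κ) (hB : 1 ≤ B) : 0 < diffScale κ B := by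
  have := sewGap_pos hκ
  unfold diffScale; positivity

theorem diffConst_pos (hκ : 1 / 3 < κ) (hB : 1 ≤ B) : 0 < diffConst κ B := by
  have := sewGap_pos hκ
  unfold diffConst; positivity

theorem diffScale_le_one (hB : 1 ≤ B) : diffScale κ B ≤ 1 := by
  have : 1 ≤ B ^ 9 := one_le_pow₀ hB
  rw [diffScale, div_le_one (by positivity)]
  linarith [sewGap_lt_one κ]

/-- On the times up to `b`, where the two solutions differ by at most `S`, the remainders of two
solutions differ by at most `diffConst κ B * S` to third order. -/
theorem norm_eulerRem_sub_le (hκ : 1 / 3 < κ) (hc : IsCoeff B σ (areaField σ))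
    (hx : IsRoughPath κ x A) (hx' : IsRoughPath κ x' A')
    (hb : RoughBound κ B x A) (hb' : RoughBound κ B x' A')
    (hd : RoughBound κ S (x - x') (A - A'))
    (hL : ∀ s t : Icc (0 : ℝ) T, |(t : ℝ) - s| ^ κ ≤ diffScale κ B →
      ‖eulerRem σ (areaField σ) x A y s t‖ ≤ B * |(t : ℝ) - s| ^ (3 * κ))
    (hL' : ∀ s t : Icc (0 : ℝ) T, |(t : ℝ) - s| ^ κ ≤ diffScale κ B →
      ‖eulerRem σ (areaField σ) x' A' y' s t‖ ≤ B * |(t : ℝ) - s| ^ (3 * κ))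
    {b : ℝ} (hS : ∀ t : Icc (0 : ℝ) T, (t : ℝ) ≤ b → ‖y t - y' t‖ ≤ S) (hS0 : 0 ≤ S)
    {s t : Icc (0 : ℝ) T} (hs : (s : ℝ) ≤ b) (ht : (t : ℝ) ≤ b)
    (hst : |(t : ℝ) - s| ^ κ ≤ diffScale κ B) :
    ‖eulerRem σ (areaField σ) x A y s t - eulerRem σ (areaField σ) x' A' y' s t‖ ≤
      diffConst κ B * S * |(t : ℝ) - s| ^ (3 * κ) := by
  have hB := hc.nonneg
  have hB1 := hc.one_le
  have hg := sewGap_pos hκ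
  have hg1 := sewGap_lt_one κ
  have hε1 := diffScale_le_one (κ := κ) hB1
  have hQ := diffConst_pos hκ hB1
  refine le_of_contraction
    (α := {p : Icc (0 : ℝ) T × Icc (0 : ℝ) T //
      (p.1 : ℝ) ≤ b ∧ (p.2 : ℝ) ≤ b ∧ |(p.2 : ℝ) - p.1| ^ κ ≤ diffScale κ B})
    (f := fun p => ‖eulerRem σ (areaField σ) x A y p.1.1 p.1.2 -
      eulerRem σ (areaField σ) x' A' y' p.1.1 p.1.2‖)
    (a := fun p => diffConst κ B * S * |(p.1.2 : ℝ) - p.1.1| ^ (3 * κ))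
    (b := fun p => |(p.1.2 : ℝ) - p.1.1| ^ (3 * κ)) (l := 1 - sewGap κ / 2) (C := 2 * B)
    (by linarith) (by linarith) (by linarith)
    (fun p => ?_) ?_ ⟨(s, t), hs, ht, hst⟩
  · refine le_trans ?_ (le_add_of_nonneg_left (by positivity))
    refine (norm_sub_le _ _).trans ((add_le_add (hL _ _ p.2.2.2) (hL' _ _ p.2.2.2)).trans ?_)
    linarith
  rintro N hN ih ⟨⟨s, t⟩, hs, ht, hst⟩
  have hl : |(mid s t : ℝ) - s| ^ κ ≤ |(t : ℝ) - s| ^ κ :=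
    rpow_le_rpow_mid_left (by linarith) s t
  have hr : |(t : ℝ) - mid s t| ^ κ ≤ |(t : ℝ) - s| ^ κ :=
    rpow_le_rpow_mid_right (by linarith) s t
  have hm : (mid s t : ℝ) ≤ b := by
    simp only [mid]; simp only at hs ht; linarith
  have i1 := ih ⟨(s, mid s t), hs, hm, hl.trans hst⟩
  have i2 := ih ⟨(mid s t, t), hm, ht, hr.trans hst⟩
  simp only [← add_mul] at i1 i2 hs ht hst ⊢
  have hh0 : 0 ≤ |(t : ℝ) - s| ^ κ := by positivity
  have cube : ∀ {K : ℝ}, 0 ≤ K → K * |(mid s t : ℝ) - s| ^ (3 * κ) ≤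
      K * (|(t : ℝ) - s| ^ κ) ^ 3 := fun hK => by
    rw [rpow_three_mul (abs_nonneg _)]; gcongr
  have dx : ∀ u v : Icc (0 : ℝ) T, |(v : ℝ) - u| ^ κ ≤ |(t : ℝ) - s| ^ κ →
      ‖(x v - x u) - (x' v - x' u)‖ ≤ S * |(t : ℝ) - s| ^ κ := fun u v huv => by
    have := hd.path_le hS0 huv
    rwa [Pi.sub_apply, Pi.sub_apply, sub_sub_sub_comm] at this
  have dA : ∀ u v : Icc (0 : ℝ) T, |(v : ℝ) - u| ^ κ ≤ |(t : ℝ) - s| ^ κ →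
      ‖A u v - A' u v‖ ≤ S * (|(t : ℝ) - s| ^ κ) ^ 2 := fun u v huv => hd.area_le hS0 huv
  have i3 := hc.norm_defect_sub_le (h := |(t : ℝ) - s| ^ κ) (S := S) (N := diffConst κ B * S + N)
    (eq_of_eulerRem (σ := σ) (F := areaField σ) x A y s (mid s t))
    (eq_of_eulerRem (σ := σ) (F := areaField σ) x' A' y' s (mid s t)) hh0 (hst.trans hε1)
    (hb.path_le hB hl) (hb.area_le hB hl) (hb.path_le hB hr) (hb.area_le hB hr)
    ((hL _ _ (hl.trans hst)).trans (cube hB)) (hb'.path_le hB hl) (hb'.area_le hB hl)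
    ((hL' _ _ (hl.trans hst)).trans (cube hB)) (hS s hs) (dx _ _ hl) (dx _ _ hr) (dA _ _ hl)
    (dA _ _ hr) (i1.trans (cube (by positivity))) (by positivity)
  have i4 := halves_le hκ s t
  rw [eulerRem_eq (hx.chenRel (σ := σ)) y s (mid s t) t,
    eulerRem_eq (hx'.chenRel (σ := σ)) y' s (mid s t) t]
  rw [← rpow_three_mul (abs_nonneg _)] at i3
  have hh3 : 0 ≤ |(t : ℝ) - s| ^ (3 * κ) := by positivity
  have i5 : 120 * B ^ 9 * (S + (diffConst κ B * S + N) * |(t : ℝ) - s| ^ κ) ≤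
      diffConst κ B * S * sewGap κ / 2 + (diffConst κ B * S + N) * (sewGap κ / 2) := by
    have e1 : 120 * B ^ 9 * (S + (diffConst κ B * S + N) * |(t : ℝ) - s| ^ κ) ≤
        120 * B ^ 9 * (S + (diffConst κ B * S + N) * diffScale κ B) := by gcongr
    refine e1.trans (le_of_eq ?_)
    unfold diffConst diffScale
    field_simp
    ring
  have i6 := mul_le_mul_of_nonneg_right i5 hh3
  have i7 := mul_le_mul_of_nonneg_left i4 (by positivity : 0 ≤ diffConst κ B * S + N)
  have tri : ∀ l r e l' r' e' : Vec d,
      ‖(l + r - e) - (l' + r' - e')‖ ≤ ‖l - l'‖ + ‖r - r'‖ + ‖e - e'‖ := by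
    intro l r e l' r' e'
    have : (l + r - e) - (l' + r' - e') = (l - l') + (r - r') - (e - e') := by abel
    rw [this]
    exact (norm_sub_le _ _).trans (add_le_add (norm_add_le _ _) le_rfl)
  refine (tri _ _ _ _ _ _).trans ?_
  calc _ ≤ (diffConst κ B * S + N) * ((1 - sewGap κ) * |(t : ℝ) - s| ^ (3 * κ)) +
        (diffConst κ B * S * sewGap κ / 2 + (diffConst κ B * S + N) * (sewGap κ / 2)) *
          |(t : ℝ) - s| ^ (3 * κ) := by linarith
    _ = _ := by ring

/-- The growth of the distance of two solutions over a small interval. -/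
theorem norm_increment_sub_le (hκ : 1 / 3 < κ) (hc : IsCoeff B σ (areaField σ))
    (hx : IsRoughPath κ x A) (hx' : IsRoughPath κ x' A')
    (hb : RoughBound κ B x A) (hb' : RoughBound κ B x' A')
    (hd : RoughBound κ S (x - x') (A - A'))
    (hL : ∀ s t : Icc (0 : ℝ) T, |(t : ℝ) - s| ^ κ ≤ diffScale κ B →
      ‖eulerRem σ (areaField σ) x A y s t‖ ≤ B * |(t : ℝ) - s| ^ (3 * κ))
    (hL' : ∀ s t : Icc (0 : ℝ) T, |(t : ℝ) - s| ^ κ ≤ diffScale κ B →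
      ‖eulerRem σ (areaField σ) x' A' y' s t‖ ≤ B * |(t : ℝ) - s| ^ (3 * κ))
    {b : ℝ} (hS : ∀ t : Icc (0 : ℝ) T, (t : ℝ) ≤ b → ‖y t - y' t‖ ≤ S) (hS0 : 0 ≤ S)
    {s t : Icc (0 : ℝ) T} (hs : (s : ℝ) ≤ b) (ht : (t : ℝ) ≤ b)
    (hst : |(t : ℝ) - s| ^ κ ≤ diffScale κ B) {r r' : ℝ} (hr : 0 ≤ r) (hr' : 0 ≤ r')
    (hxr : ‖x t - x s‖ ≤ B * r) (hAr : ‖A s t‖ ≤ B * r')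
    (hdr : ‖(x t - x s) - (x' t - x' s)‖ ≤ S * r) (hdAr : ‖A s t - A' s t‖ ≤ S * r') :
    ‖(y t - y s) - (y' t - y' s)‖ ≤
      2 * B ^ 2 * S * (r + r') + diffConst κ B * S * |(t : ℝ) - s| ^ (3 * κ) := by
  have e1 := norm_eulerRem_sub_le hκ hc hx hx' hb hb' hd hL hL' hS hS0 hs ht hst
  have e2 := hc.norm_step_sub_le (hS s hs) hxr hAr hdr hdAr hr hr'
  have e3 : (y t - y s) - (y' t - y' s) =
      ((σ (y s) (x t - x s) + areaField σ (y s) (A s t)) -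
        (σ (y' s) (x' t - x' s) + areaField σ (y' s) (A' s t))) -
      (eulerRem σ (areaField σ) x A y s t - eulerRem σ (areaField σ) x' A' y' s t) := by
    simp only [eulerRem]; abel
  rw [e3]
  exact (norm_sub_le _ _).trans (add_le_add e2 e1)

/-- The scale on which the difference of two solutions at most doubles. -/
def doublingScale (κ B : ℝ) : ℝ :=
  diffScale κ B * (1 / (2 * (4 * B ^ 2 + diffConst κ B)))

theorem doublingScale_pos (hκ : 1 / 3 < κ) (hB : 1 ≤ B) : 0 < doublingScale κ B := by
  have := diffScale_pos hκ hB
  have := diffConst_pos hκ hB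
  unfold doublingScale; positivity

theorem doublingScale_le (hκ : 1 / 3 < κ) (hB : 1 ≤ B) : doublingScale κ B ≤ diffScale κ B := by
  have h1 := diffScale_pos hκ hB
  have h2 := diffConst_pos hκ hB
  have h3 : 1 ≤ B ^ 2 := one_le_pow₀ hB
  refine mul_le_of_le_one_right h1.le ?_
  rw [div_le_one (by positivity)]
  linarith

theorem mul_doublingScale_le (hκ : 1 / 3 < κ) (hB : 1 ≤ B) :
    (4 * B ^ 2 + diffConst κ B) * doublingScale κ B ≤ 1 / 2 := by
  have h1 := diffScale_le_one (κ := κ) hB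
  have h2 := diffConst_pos hκ hB
  have h3 : (4 * B ^ 2 + diffConst κ B) * doublingScale κ B = diffScale κ B / 2 := by
    unfold doublingScale; field_simp
  linarith

/-- The distance of two solutions doubles at most on each interval of a subdivision, so that it is
controlled on `[0,T]` by the distance `D` of the data. -/
theorem norm_sub_le_two_pow (hκ : 1 / 3 < κ) (hc : IsCoeff B σ (areaField σ))
    (hx : IsRoughPath κ x A) (hx' : IsRoughPath κ x' A')
    (hb : RoughBound κ B x A) (hb' : RoughBound κ B x' A')
    (hd : RoughBound κ D (x - x') (A - A')) (hD : 0 ≤ D)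
    (hL : ∀ s t : Icc (0 : ℝ) T, |(t : ℝ) - s| ^ κ ≤ diffScale κ B →
      ‖eulerRem σ (areaField σ) x A y s t‖ ≤ B * |(t : ℝ) - s| ^ (3 * κ))
    (hL' : ∀ s t : Icc (0 : ℝ) T, |(t : ℝ) - s| ^ κ ≤ diffScale κ B →
      ‖eulerRem σ (areaField σ) x' A' y' s t‖ ≤ B * |(t : ℝ) - s| ^ (3 * κ))
    (hy : Continuous y) (hy' : Continuous y')
    (h0 : ∀ t : Icc (0 : ℝ) T, (t : ℝ) = 0 → ‖y t - y' t‖ ≤ D) (k : ℕ) :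
    ∀ t : Icc (0 : ℝ) T, (t : ℝ) ≤ k * doublingScale κ B ^ (1 / κ) →
      ‖y t - y' t‖ ≤ 2 ^ k * D := by
  have hB1 := hc.one_le
  have hQ := diffConst_pos hκ hB1
  have hε := doublingScale_pos hκ hB1
  set τ := doublingScale κ B ^ (1 / κ) with hτ
  have hτ0 : 0 < τ := Real.rpow_pos_of_pos hε _
  obtain ⟨C, hC⟩ := isCompact_univ.exists_bound_of_continuousOn (hy.sub hy').continuousOn
  induction k with
  | zero =>
    intro t ht
    simp only [Nat.cast_zero, zero_mul] at ht
    simpa using h0 t (le_antisymm ht t.2.1)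
  | succ k ih =>
    have e : ∀ N : ℝ, (2 : ℝ) ^ (k + 1) * D + N = 2 * (2 ^ k * D) + N := fun N => by ring
    have h2D : D ≤ 2 ^ k * D := le_mul_of_one_le_left hD (one_le_pow₀ (by norm_num))
    intro t ht
    refine le_of_contraction
      (α := {t : Icc (0 : ℝ) T // (t : ℝ) ≤ (k + 1 : ℕ) * τ})
      (f := fun t => ‖y t - y' t‖) (a := fun _ => 2 ^ (k + 1) * D) (b := fun _ => 1)
      (l := 1 / 2) (C := max C 0) (by norm_num) (by norm_num) (le_max_right _ _) (fun t => ?_)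
      ?_ ⟨t, ht⟩
    · have h1 : ‖y t - y' t‖ ≤ C := hC t (mem_univ _)
      have h2 : (0 : ℝ) ≤ 2 ^ (k + 1) * D := by positivity
      simp only [mul_one]
      linarith [le_max_left C 0]
    rintro N hN hbd ⟨t, ht⟩
    simp only [mul_one] at hbd ⊢
    set S := 2 ^ (k + 1) * D + N with hSdef
    have hDS : D ≤ S := by rw [hSdef, e]; linarith
    have hS0 : 0 ≤ S := hD.trans hDS
    have hs0 : 0 ≤ max ((t : ℝ) - τ) 0 := le_max_right _ _
    have hst : max ((t : ℝ) - τ) 0 ≤ t := max_le (by linarith) t.2.1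
    let s : Icc (0 : ℝ) T := ⟨max ((t : ℝ) - τ) 0, hs0, hst.trans t.2.2⟩
    have hs : (s : ℝ) ≤ k * τ := by
      refine max_le ?_ (by positivity)
      push_cast at ht
      linarith
    have hsb : (s : ℝ) ≤ (k + 1 : ℕ) * τ := hst.trans ht
    have hlen : |(t : ℝ) - s| ≤ τ := by
      rw [abs_of_nonneg (sub_nonneg.2 hst)]
      have : (t : ℝ) - τ ≤ s := le_max_left _ _
      linarith
    set h := |(t : ℝ) - s| ^ κ with hh
    have hhε : h ≤ doublingScale κ B :=
      (rpow_le_iff_le_scale (by linarith) hε (abs_nonneg _)).2 hlen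
    have hhd := hhε.trans (doublingScale_le hκ hB1)
    have hh0 : 0 ≤ h := by positivity
    have hh1 : h ≤ 1 := hhd.trans (diffScale_le_one hB1)
    have hdS := hd.mono hDS
    have key := norm_increment_sub_le hκ hc hx hx' hb hb' hdS hL hL'
      (b := (k + 1 : ℕ) * τ) (fun t ht => hbd ⟨t, ht⟩) hS0 hsb ht hhd hh0 (sq_nonneg h)
      (hb.path_le hc.nonneg le_rfl) (hb.area_le hc.nonneg le_rfl)
      (by simpa [sub_sub_sub_comm] using hdS.path_le hS0 (le_refl h))
      (hdS.area_le hS0 (le_refl h))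
    rw [rpow_three_mul (abs_nonneg _), ← hh] at key
    have key2 : ‖(y t - y s) - (y' t - y' s)‖ ≤ S / 2 := by
      calc _ ≤ 2 * B ^ 2 * S * (h + h ^ 2) + diffConst κ B * S * h ^ 3 := key
        _ ≤ 2 * B ^ 2 * S * (h + h) + diffConst κ B * S * h := by
            gcongr
            · exact pow_le_of_le_one hh0 hh1 (by norm_num)
            · exact pow_le_of_le_one hh0 hh1 (by norm_num)
        _ = S * ((4 * B ^ 2 + diffConst κ B) * h) := by ring
        _ ≤ S * ((4 * B ^ 2 + diffConst κ B) * doublingScale κ B) := by gcongr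
        _ ≤ S * (1 / 2) := by gcongr; exact mul_doublingScale_le hκ hB1
        _ = S / 2 := by ring
    have split : y t - y' t = ((y t - y s) - (y' t - y' s)) + (y s - y' s) := by abel
    rw [split]
    have h3 := norm_add_le ((y t - y s) - (y' t - y' s)) (y s - y' s)
    have h4 := ih s hs
    rw [e]
    have h5 : S / 2 = 2 ^ k * D + N / 2 := by rw [hSdef, e]; ring
    linarith

end Stability

/-! ### Lipschitz continuity of the Itô map -/

section Lipschitz

variable {T : ℝ} {d m : ℕ} {κ γ B D : ℝ} {σ : Vec d → Mat d m} {x x' : Path1 T (Vec m)}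
  {A A' : Path2 T (Area m)} {a a' : Vec d} {y y' : Path1 T (Vec d)} {ζ ζ' : Path1 T (Mat d m)}

theorem MemC2.sub {V : Type} [NormedAddCommGroup V] {μ : ℝ} {g g' : Path2 T V} (h : MemC2 μ g)
    (h' : MemC2 μ g') : MemC2 μ (g - g') where
  continuous := h.continuous.sub h'.continuous
  diag s := by simp [h.diag, h'.diag]
  bddAbove := bddAbove_quot2 (add_nonneg norm2_nonneg norm2_nonneg) fun s t =>
    (norm_sub_le _ _).trans ((add_le_add (h.norm_le s t) (h'.norm_le s t)).trans
      (add_mul _ _ _).ge)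

theorem delta1_sub {V : Type} [NormedAddCommGroup V] (f f' : Path1 T V) :
    delta1 (f - f') = delta1 f - delta1 f' := by
  funext s t
  simp only [delta1, Pi.sub_apply]
  abel

theorem MemC1.sub {V : Type} [NormedAddCommGroup V] {μ : ℝ} {f f' : Path1 T V} (h : MemC1 μ f)
    (h' : MemC1 μ f') : MemC1 μ (f - f') where
  continuous := h.continuous.sub h'.continuous
  bddAbove := by rw [delta1_sub]; exact (h.memC2.sub h'.memC2).bddAbove

theorem RoughBound.of_memC (hx : MemC1 γ x) (hA : MemC2 (2 * γ) A) (h1 : holderNorm γ x ≤ B)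
    (h2 : norm2 (2 * γ) A ≤ B) : RoughBound γ B x A where
  path s t := (hx.norm_le s t).trans (by gcongr; exact norm2_le_holderNorm.trans h1)
  area s t := (hA.norm_le s t).trans (by gcongr)

/-- The constant of the embedding of `γ`-Hölder rough paths into `κ`-Hölder rough paths. -/
def embedConst (T κ γ : ℝ) : ℝ := 1 + T ^ (γ - κ) + T ^ (2 * γ - 2 * κ)

theorem one_le_embedConst (hT : 0 ≤ T) : 1 ≤ embedConst T κ γ := by
  have : 0 ≤ T ^ (γ - κ) := by positivity
  have : 0 ≤ T ^ (2 * γ - 2 * κ) := by positivity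
  unfold embedConst; linarith

theorem RoughBound.of_exponent_le (hT : 0 ≤ T) (hκ : 0 ≤ κ) (hκγ : κ ≤ γ) (hB : 0 ≤ B)
    (h : RoughBound γ B x A) : RoughBound κ (embedConst T κ γ * B) x A := by
  have h1 : 0 ≤ T ^ (γ - κ) := by positivity
  have h2 : 0 ≤ T ^ (2 * γ - 2 * κ) := by positivity
  have e1 : T ^ (γ - κ) ≤ embedConst T κ γ := by unfold embedConst; linarith
  have e2 : T ^ (2 * γ - 2 * κ) ≤ embedConst T κ γ := by unfold embedConst; linarith
  constructor
  · intro s t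
    refine (bound_of_exponent_le (g := delta1 x) hκ hκγ hB h.path s t).trans ?_
    rw [mul_comm B]
    gcongr
  · intro s t
    refine (bound_of_exponent_le (μ := 2 * κ) (by linarith) (by linarith) hB h.area s t).trans ?_
    rw [mul_comm B]
    gcongr

theorem diffScale_le_smallScale {B' : ℝ} (hκ : 1 / 3 < κ) (hB : 1 ≤ B) (hBB : B ≤ B') :
    diffScale κ B' ≤ smallScale κ B := by
  have hB' : 1 ≤ B' := hB.trans hBB
  have h1 : B ^ 2 ≤ B' ^ 9 :=
    (pow_le_pow_left₀ (by linarith) hBB 2).trans (pow_le_pow_right₀ hB' (by norm_num))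
  have hg := sewGap_pos hκ
  unfold diffScale smallScale
  gcongr
  · linarith

/-- A solution inherits the Hölder exponent of the driving path. -/
theorem IsSolution.memC1 (hT : 0 ≤ T) (hγ0 : 0 ≤ γ) (hγ : γ ≤ 1)
    (hc : IsCoeff B σ (areaField σ)) (hx : IsRoughPath γ x A) (h : IsSolution κ σ a x A y ζ) :
    MemC1 γ y := by
  obtain ⟨μ, C, hμ, hC, hL⟩ := h.exists_eulerRem_bound
  have hB := hc.nonneg
  have n1 := norm2_nonneg (μ := γ) (g := delta1 x)
  have n2 := norm2_nonneg (μ := 2 * γ) (g := A)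
  refine ⟨h.controlled.path.continuous, bddAbove_quot2 (C := B * norm2 γ (delta1 x) +
    B * (norm2 (2 * γ) A * T ^ (2 * γ - γ)) + C * T ^ (μ - γ)) (by positivity) fun s t => ?_⟩
  have e1 := ContinuousLinearMap.le_of_opNorm_le_of_le _ (hc.field.bound (y s))
    (hx.path.norm_le s t)
  have e2 := ContinuousLinearMap.le_of_opNorm_le_of_le _ (hc.area.bound (y s))
    (bound_of_exponent_le hγ0 (by linarith) n2 hx.area.norm_le s t)
  have e3 := bound_of_exponent_le (g := eulerRem σ (areaField σ) x A y) hγ0 (by linarith) hC hL s t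
  have e : delta1 y s t = σ (y s) (x t - x s) + areaField σ (y s) (A s t) -
      eulerRem σ (areaField σ) x A y s t := by
    simp [eulerRem, delta1]
  rw [e]
  calc _ ≤ B * (norm2 γ (delta1 x) * |(t : ℝ) - s| ^ γ) +
        B * (norm2 (2 * γ) A * T ^ (2 * γ - γ) * |(t : ℝ) - s| ^ γ) +
        C * T ^ (μ - γ) * |(t : ℝ) - s| ^ γ :=
        (norm_sub_le _ _).trans (add_le_add ((norm_add_le _ _).trans (add_le_add e1 e2)) e3)
    _ = _ := by ring

/-- Local Lipschitz continuity of the Itô map, with a constant that is uniform over all rough paths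
whose norms are at most `R`. -/
theorem exists_lipschitz_const (hκ : 1 / 3 < κ) (hκγ : κ < γ) (hγ : γ ≤ 1) (hT : 0 < T)
    (hc : IsCoeff B σ (areaField σ)) {R : ℝ} (hR : 0 ≤ R) :
    ∃ C, 0 ≤ C ∧ ∀ (a a' : Vec d) (x x' : Path1 T (Vec m)) (A A' : Path2 T (Area m)),
      IsRoughPath γ x A → IsRoughPath γ x' A' →
      holderNorm γ x ≤ R → holderNorm γ x' ≤ R → norm2 (2 * γ) A ≤ R → norm2 (2 * γ) A' ≤ R →
      ∀ y ζ y' ζ', IsSolution κ σ a x A y ζ → IsSolution κ σ a' x' A' y' ζ' →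
        holderNorm γ (y - y') ≤
          C * (‖a - a'‖ + holderNorm γ (x - x') + norm2 (2 * γ) (A - A')) := by
  have hκ0 : 0 ≤ κ := by linarith
  have hγ0 : 0 < γ := by linarith
  set c := embedConst T κ γ with hcdef
  have hc1 : 1 ≤ c := one_le_embedConst hT.le
  set B₁ := max B (c * R) with hB₁
  have hc₁ : IsCoeff B₁ σ (areaField σ) := hc.mono (le_max_left _ _)
  have hB₁1 := hc₁.one_le
  have hQ₁ := remConst_pos hκ hB₁1
  set B₂ := B₁ + remConst κ B₁ with hB₂
  have hB₁₂ : B₁ ≤ B₂ := by linarith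
  have hc₂ : IsCoeff B₂ σ (areaField σ) := hc₁.mono hB₁₂
  have hB₂0 := hc₂.nonneg
  have hB₂1 := hc₂.one_le
  have hQ := diffConst_pos hκ hB₂1
  have hε := doublingScale_pos hκ hB₂1
  set τ := doublingScale κ B₂ ^ (1 / κ) with hτ
  have hτ0 : 0 < τ := Real.rpow_pos_of_pos hε _
  have hτγ : 0 < τ ^ γ := Real.rpow_pos_of_pos hτ0 _
  set n := coverNum κ T (doublingScale κ B₂) with hn
  set E := 2 * B₂ ^ 2 * (1 + T ^ (2 * γ - γ)) + diffConst κ B₂ * T ^ (3 * κ - γ) + 2 / τ ^ γ with hE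
  have hE0 : 0 ≤ E := by positivity
  refine ⟨2 ^ n * c * (1 + E), by positivity, ?_⟩
  intro a a' x x' A A' hx hx' nx nx' nA nA' y ζ y' ζ' hy hy'
  have hdx := hx.path.sub hx'.path
  have hdA := hx.area.sub hx'.area
  have n1 : 0 ≤ holderNorm γ (x - x') := add_nonneg supNorm_nonneg norm2_nonneg
  have n2 := norm2_nonneg (μ := 2 * γ) (g := A - A')
  set Δ := ‖a - a'‖ + holderNorm γ (x - x') + norm2 (2 * γ) (A - A') with hΔ
  have hΔ0 : 0 ≤ Δ := by positivity
  have hΔc : Δ ≤ c * Δ := le_mul_of_one_le_left hΔ0 hc1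
  set S := 2 ^ n * (c * Δ) with hS
  have hcS : c * Δ ≤ S := le_mul_of_one_le_left (by positivity) (one_le_pow₀ (by norm_num))
  have hS0 : 0 ≤ S := by positivity
  -- all bounds on the two driving rough paths and on their difference
  have hRB : R ≤ B₂ := (le_mul_of_one_le_left hR hc1).trans ((le_max_right _ _).trans hB₁₂)
  have bγ : RoughBound γ R x A := .of_memC hx.path hx.area nx nA
  have bγ' : RoughBound γ R x' A' := .of_memC hx'.path hx'.area nx' nA'
  have bd : RoughBound γ Δ (x - x') (A - A') :=
    .of_memC hdx hdA (by linarith [norm_nonneg (a - a')]) (by linarith [norm_nonneg (a - a')])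
  have bκ : RoughBound κ B₁ x A :=
    (bγ.of_exponent_le hT.le hκ0 hκγ.le hR).mono (le_max_right _ _)
  have bκ' : RoughBound κ B₁ x' A' :=
    (bγ'.of_exponent_le hT.le hκ0 hκγ.le hR).mono (le_max_right _ _)
  have bdκ : RoughBound κ (c * Δ) (x - x') (A - A') := bd.of_exponent_le hT.le hκ0 hκγ.le hΔ0
  have rκ := hx.mono hT.le hκ0 hκγ.le
  have rκ' := hx'.mono hT.le hκ0 hκγ.le
  have hL : ∀ s t : Icc (0 : ℝ) T, |(t : ℝ) - s| ^ κ ≤ diffScale κ B₂ →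
      ‖eulerRem σ (areaField σ) x A y s t‖ ≤ B₂ * |(t : ℝ) - s| ^ (3 * κ) := fun s t hst =>
    (hy.eulerRem_le hκ hc₁ rκ bκ (hst.trans (diffScale_le_smallScale hκ hB₁1 hB₁₂))).trans
      (by gcongr; linarith)
  have hL' : ∀ s t : Icc (0 : ℝ) T, |(t : ℝ) - s| ^ κ ≤ diffScale κ B₂ →
      ‖eulerRem σ (areaField σ) x' A' y' s t‖ ≤ B₂ * |(t : ℝ) - s| ^ (3 * κ) := fun s t hst =>
    (hy'.eulerRem_le hκ hc₁ rκ' bκ' (hst.trans (diffScale_le_smallScale hκ hB₁1 hB₁₂))).trans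
      (by gcongr; linarith)
  have hsup : ∀ t, ‖y t - y' t‖ ≤ S := fun t =>
    norm_sub_le_two_pow hκ hc₂ rκ rκ' (bκ.mono hB₁₂) (bκ'.mono hB₁₂) bdκ (by positivity) hL hL'
      hy.controlled.path.continuous hy'.controlled.path.continuous
      (fun t ht => by
        rw [hy.controlled.initial t ht, hy'.controlled.initial t ht]
        linarith) n t (t.2.2.trans (le_coverNum hε T))
  have hincr : ∀ s t, ‖delta1 (y - y') s t‖ ≤ S * E * |(t : ℝ) - s| ^ γ := by
    intro s t
    have hr0 : 0 ≤ |(t : ℝ) - s| ^ γ := by positivity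
    have e : delta1 (y - y') s t = (y t - y s) - (y' t - y' s) := by rw [delta1_sub]; rfl
    rcases le_or_gt |(t : ℝ) - s| τ with hst | hst
    · have hstκ : |(t : ℝ) - s| ^ κ ≤ diffScale κ B₂ :=
        ((rpow_le_iff_le_scale (by linarith) hε (abs_nonneg _)).2 hst).trans
          (doublingScale_le hκ hB₂1)
      have bdS := bd.mono (hΔc.trans hcS)
      have key := norm_increment_sub_le hκ hc₂ rκ rκ' (bκ.mono hB₁₂) (bκ'.mono hB₁₂)
        (bdκ.mono hcS) hL hL' (b := T) (fun t _ => hsup t) hS0 s.2.2 t.2.2 hstκ hr0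
        (by positivity : 0 ≤ |(t : ℝ) - s| ^ (2 * γ)) ((bγ.mono hRB).path s t)
        ((bγ.mono hRB).area s t) (by simpa [sub_sub_sub_comm] using bdS.path s t) (bdS.area s t)
      have k1 := rpow_le_rpow_mul_rpow (μ := γ) (ν := 2 * γ) hγ0.le (by linarith)
        (abs_nonneg ((t : ℝ) - s)) (abs_sub_le_length s t)
      have k2 := rpow_le_rpow_mul_rpow (μ := γ) (ν := 3 * κ) hγ0.le (by linarith)
        (abs_nonneg ((t : ℝ) - s)) (abs_sub_le_length s t)
      rw [e]
      calc _ ≤ _ := key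
        _ ≤ 2 * B₂ ^ 2 * S * (|(t : ℝ) - s| ^ γ + T ^ (2 * γ - γ) * |(t : ℝ) - s| ^ γ) +
            diffConst κ B₂ * S * (T ^ (3 * κ - γ) * |(t : ℝ) - s| ^ γ) := by gcongr
        _ = S * (2 * B₂ ^ 2 * (1 + T ^ (2 * γ - γ)) + diffConst κ B₂ * T ^ (3 * κ - γ) + 0) *
            |(t : ℝ) - s| ^ γ := by ring
        _ ≤ S * E * |(t : ℝ) - s| ^ γ := by rw [hE]; gcongr; positivity
    · have k1 : τ ^ γ ≤ |(t : ℝ) - s| ^ γ := by gcongr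
      have k2 : delta1 (y - y') s t = (y t - y' t) - (y s - y' s) := rfl
      rw [k2]
      calc _ ≤ S + S := (norm_sub_le _ _).trans (add_le_add (hsup t) (hsup s))
        _ = S * (2 / τ ^ γ) * τ ^ γ := by field_simp; norm_num
        _ ≤ S * E * |(t : ℝ) - s| ^ γ := by
          gcongr
          rw [hE]
          exact le_add_of_nonneg_left (by positivity)
  calc holderNorm γ (y - y') ≤ S + S * E :=
        add_le_add (supNorm_le hS0 hsup) (norm2_le (by positivity) hincr)
    _ = _ := by rw [hS]; ring

end Lipschitz

/-! ### The Euler scheme -/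

section Scheme

variable {E V W : Type*} [NormedAddCommGroup E] [NormedSpace ℝ E]
  [NormedAddCommGroup V] [NormedSpace ℝ V] [NormedAddCommGroup W] [NormedSpace ℝ W]
  {σ : E → V →L[ℝ] E} {F : E → W →L[ℝ] E} {B κ δ : ℝ}

/-- The second-order Euler scheme along a sequence of times. -/
def eulerScheme (σ : E → V →L[ℝ] E) (F : E → W →L[ℝ] E) (a : E) (x : ℕ → V) (A : ℕ → ℕ → W) :
    ℕ → E
  | 0 => a
  | k + 1 => eulerScheme σ F a x A k + (σ (eulerScheme σ F a x A k) (x (k + 1) - x k) +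
      F (eulerScheme σ F a x A k) (A k (k + 1)))

/-- The remainder of the scheme is of third order, uniformly in the step `δ`. -/
theorem norm_eulerRem_eulerScheme_le (hκ : 1 / 3 < κ) (hδ : 0 ≤ δ) (hc : IsCoeff B σ F) (a : E)
    {x : ℕ → V} {A : ℕ → ℕ → W} (hch : ChenRel σ F x A) (hA0 : ∀ i, A i i = 0)
    (hx : ∀ i n : ℕ, ‖x (i + n) - x i‖ ≤ B * (n * δ) ^ κ)
    (hA : ∀ i n : ℕ, ‖A i (i + n)‖ ≤ B * ((n * δ) ^ κ) ^ 2) (n : ℕ) :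
    ∀ i : ℕ, (n * δ) ^ κ ≤ smallScale κ B →
      ‖eulerRem σ F x A (eulerScheme σ F a x A) i (i + n)‖ ≤ remConst κ B * (n * δ) ^ (3 * κ) := by
  have hB1 := hc.one_le
  have hB := hc.nonneg
  have hQ := remConst_pos hκ hB1
  induction n using Nat.strong_induction_on with
  | _ n ih =>
    intro i hn
    rcases Nat.lt_or_ge n 2 with hn2 | hn2
    · have : eulerRem σ F x A (eulerScheme σ F a x A) i (i + n) = 0 := by
        interval_cases n <;> simp [eulerRem, eulerScheme, hA0]
      rw [this, norm_zero]
      positivity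
    obtain ⟨p, q, rfl, hp, hq, hpn, hqn⟩ : ∃ p q, n = p + q ∧ 3 * p ≤ 2 * n ∧ 3 * q ≤ 2 * n ∧
        p < n ∧ q < n := ⟨n / 2, n - n / 2, by omega, by omega, by omega, by omega, by omega⟩
    have hp' : (3 : ℝ) * p ≤ 2 * (p + q) := by exact_mod_cast hp
    have hq' : (3 : ℝ) * q ≤ 2 * (p + q) := by exact_mod_cast hq
    have lp : (p * δ) ^ κ ≤ ((p + q : ℕ) * δ) ^ κ :=
      Real.rpow_le_rpow (by positivity) (by gcongr) (by linarith)
    have lq : (q * δ) ^ κ ≤ ((p + q : ℕ) * δ) ^ κ :=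
      Real.rpow_le_rpow (by positivity) (by gcongr) (by linarith)
    have i1 := ih p hpn i (lp.trans hn)
    have i2 := ih q hqn (i + p) (lq.trans hn)
    have i4 := rpow_add_rpow_le_sewGap (u := p * δ) (v := q * δ) hκ (by positivity) (by positivity)
      (by nlinarith) (by nlinarith)
    have hh0 : 0 ≤ ((p + q : ℕ) * δ) ^ κ := by positivity
    have i3 := hc.norm_defect_le (h := ((p + q : ℕ) * δ) ^ κ) (N := remConst κ B)
      (eq_of_eulerRem (σ := σ) (F := F) x A (eulerScheme σ F a x A) i (i + p)) hh0
      (hn.trans (smallScale_le_one hB1)) ((hx i p).trans (by gcongr))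
      ((hx (i + p) q).trans (by gcongr)) ((hA i p).trans (by gcongr))
      ((hA (i + p) q).trans (by gcongr))
      (i1.trans (by rw [rpow_three_mul (by positivity)]; gcongr)) hQ.le
    have e1 : 2 * B ^ 2 * remConst κ B * ((p + q : ℕ) * δ) ^ κ ≤
        2 * B ^ 2 * remConst κ B * smallScale κ B := by gcongr
    have e2 : 2 * B ^ 2 * remConst κ B * smallScale κ B = remConst κ B * (sewGap κ / 2) := by
      rw [← two_mul_smallScale hB1]; ring
    have e3 := remConst_mul_sewGap (B := B) hκ
    rw [← rpow_three_mul (by positivity)] at i3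
    have hh3 : 0 ≤ ((p + q : ℕ) * δ) ^ (3 * κ) := by positivity
    have i5 : 7 * B ^ 6 + 2 * B ^ 2 * remConst κ B * ((p + q : ℕ) * δ) ^ κ ≤
        remConst κ B * sewGap κ := by linarith
    have i6 := mul_le_mul_of_nonneg_right i5 hh3
    have i7 := mul_le_mul_of_nonneg_left i4 hQ.le
    rw [← add_mul, ← Nat.cast_add] at i7
    rw [eulerRem_eq hch _ i (i + p) (i + (p + q)), ← add_assoc]
    refine (norm_sub_le _ _).trans ((add_le_add (norm_add_le _ _) le_rfl).trans ?_)
    calc _ ≤ remConst κ B * ((1 - sewGap κ) * ((p + q : ℕ) * δ) ^ (3 * κ)) +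
          remConst κ B * sewGap κ * ((p + q : ℕ) * δ) ^ (3 * κ) := by linarith
      _ = _ := by ring

theorem norm_eulerScheme_sub_le (hκ : 1 / 3 < κ) (hδ : 0 ≤ δ) (hc : IsCoeff B σ F) (a : E)
    {x : ℕ → V} {A : ℕ → ℕ → W} (hch : ChenRel σ F x A) (hA0 : ∀ i, A i i = 0)
    (hx : ∀ i n : ℕ, ‖x (i + n) - x i‖ ≤ B * (n * δ) ^ κ)
    (hA : ∀ i n : ℕ, ‖A i (i + n)‖ ≤ B * ((n * δ) ^ κ) ^ 2) (i n : ℕ)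
    (hn : (n * δ) ^ κ ≤ smallScale κ B) :
    ‖eulerScheme σ F a x A (i + n) - eulerScheme σ F a x A i‖ ≤ 2 * B ^ 2 + remConst κ B := by
  have hB1 := hc.one_le
  have hQ := remConst_pos hκ hB1
  have h1 := hn.trans (smallScale_le_one hB1)
  have h0 : 0 ≤ (n * δ) ^ κ := by positivity
  have e1 := norm_eulerRem_eulerScheme_le hκ hδ hc a hch hA0 hx hA n i hn
  rw [rpow_three_mul (by positivity)] at e1
  have e2 := hc.norm_step_le (eulerScheme σ F a x A i) h0 h1 (hx i n) (hA i n)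
  rw [eq_of_eulerRem (σ := σ) (F := F) x A (eulerScheme σ F a x A) i (i + n), add_sub_cancel_left]
  calc _ ≤ 2 * B ^ 2 * (n * δ) ^ κ + remConst κ B * ((n * δ) ^ κ) ^ 3 :=
        (norm_sub_le _ _).trans (add_le_add e2 e1)
    _ ≤ 2 * B ^ 2 * 1 + remConst κ B * 1 := by
        gcongr
        exact pow_le_one₀ h0 h1
    _ = _ := by ring

/-- The scheme is bounded over `(K + 1)` blocks of `l` steps, if a block is below the small scale. -/
theorem norm_eulerScheme_le (hκ : 1 / 3 < κ) (hδ : 0 ≤ δ) (hc : IsCoeff B σ F) (a : E)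
    {x : ℕ → V} {A : ℕ → ℕ → W} (hch : ChenRel σ F x A) (hA0 : ∀ i, A i i = 0)
    (hx : ∀ i n : ℕ, ‖x (i + n) - x i‖ ≤ B * (n * δ) ^ κ)
    (hA : ∀ i n : ℕ, ‖A i (i + n)‖ ≤ B * ((n * δ) ^ κ) ^ 2) {l K : ℕ} (hl : 0 < l)
    (hlε : (l * δ) ^ κ ≤ smallScale κ B) {k : ℕ} (hk : k ≤ K * l) :
    ‖eulerScheme σ F a x A k - a‖ ≤ (K + 1) * (2 * B ^ 2 + remConst κ B) := by
  have hQ := remConst_pos hκ hc.one_le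
  have blocks : ∀ j : ℕ, ‖eulerScheme σ F a x A (j * l) - a‖ ≤
      j * (2 * B ^ 2 + remConst κ B) := by
    intro j
    induction j with
    | zero => simp [eulerScheme]
    | succ j ih =>
      have h1 := norm_eulerScheme_sub_le hκ hδ hc a hch hA0 hx hA (j * l) l hlε
      rw [add_one_mul]
      have e : eulerScheme σ F a x A (j * l + l) - a =
          (eulerScheme σ F a x A (j * l + l) - eulerScheme σ F a x A (j * l)) +
            (eulerScheme σ F a x A (j * l) - a) := by abel
      rw [e]
      push_cast
      linarith [norm_add_le (eulerScheme σ F a x A (j * l + l) - eulerScheme σ F a x A (j * l))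
        (eulerScheme σ F a x A (j * l) - a)]
  have hmod : k % l < l := Nat.mod_lt _ hl
  have h1 := norm_eulerScheme_sub_le hκ hδ hc a hch hA0 hx hA (k / l * l) (k % l)
    ((Real.rpow_le_rpow (by positivity) (by gcongr) (by linarith)).trans hlε)
  rw [Nat.div_add_mod' k l] at h1
  have h2 := blocks (k / l)
  have h3 : ((k / l : ℕ) : ℝ) ≤ K := by
    exact_mod_cast Nat.div_le_of_le_mul (by rwa [mul_comm])
  have h4 : ((k / l : ℕ) : ℝ) * (2 * B ^ 2 + remConst κ B) ≤
    K * (2 * B ^ 2 + remConst κ B) := by gcongr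
  have e : eulerScheme σ F a x A k - a =
      (eulerScheme σ F a x A k - eulerScheme σ F a x A (k / l * l)) +
        (eulerScheme σ F a x A (k / l * l) - a) := by abel
  rw [e]
  linarith [norm_add_le (eulerScheme σ F a x A k - eulerScheme σ F a x A (k / l * l))
    (eulerScheme σ F a x A (k / l * l) - a)]

end Scheme

/-! ### Solutions from third-order remainders -/

section Existence

variable {T : ℝ} {d m : ℕ} {κ B N τ : ℝ} {σ : Vec d → Mat d m} {x : Path1 T (Vec m)}
  {A : Path2 T (Area m)} {a : Vec d} {y : Path1 T (Vec d)}

theorem continuous_of_local_bound {V : Type*} [NormedAddCommGroup V] {f : Icc (0 : ℝ) T → V}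
    {τ C κ : ℝ} (hκ : 0 < κ) (hτ : 0 < τ)
    (h : ∀ s t : Icc (0 : ℝ) T, |(t : ℝ) - s| ≤ τ → ‖f t - f s‖ ≤ C * |(t : ℝ) - s| ^ κ) :
    Continuous f := by
  rw [continuous_iff_continuousAt]
  intro s
  rw [ContinuousAt, tendsto_iff_norm_sub_tendsto_zero]
  have c1 : Continuous fun t : Icc (0 : ℝ) T => |(t : ℝ) - s| := by fun_prop
  have l1 : Filter.Tendsto (fun t : Icc (0 : ℝ) T => |(t : ℝ) - s|) (nhds s) (nhds 0) := by
    simpa using c1.tendsto s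
  have l2 : Filter.Tendsto (fun t : Icc (0 : ℝ) T => C * |(t : ℝ) - s| ^ κ) (nhds s) (nhds 0) := by
    have := (l1.rpow_const (p := κ) (Or.inr hκ.le)).const_mul C
    rwa [Real.zero_rpow hκ.ne', mul_zero] at this
  refine squeeze_zero' (Filter.Eventually.of_forall fun t => norm_nonneg _) ?_ l2
  filter_upwards [l1.eventually (gt_mem_nhds hτ)] with t ht
  exact h s t ht.le

/-- A path whose remainder is of third order on small intervals is a solution. -/
theorem isSolution_of_local (hκ : 1 / 3 < κ) (hT : 0 ≤ T) (hc : IsCoeff B σ (areaField σ))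
    (hx : IsRoughPath κ x A) (hb : RoughBound κ B x A)
    (h0 : ∀ t : Icc (0 : ℝ) T, (t : ℝ) = 0 → y t = a) (hτ : 0 < τ) (hτ1 : τ ≤ 1) (hN : 0 ≤ N)
    (h : ∀ s t : Icc (0 : ℝ) T, |(t : ℝ) - s| ≤ τ →
      ‖eulerRem σ (areaField σ) x A y s t‖ ≤ N * |(t : ℝ) - s| ^ (3 * κ)) :
    IsSolution κ σ a x A y fun t => σ (y t) := by
  have hκ0 : 0 < κ := by linarith
  have hB := hc.nonneg
  have hloc : ∀ s t : Icc (0 : ℝ) T, |(t : ℝ) - s| ≤ τ →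
      ‖y t - y s‖ ≤ (2 * B ^ 2 + N) * |(t : ℝ) - s| ^ κ := fun s t hst =>
    norm_sub_le_of_eulerRem hc hb hN
      (Real.rpow_le_one (abs_nonneg _) (hst.trans hτ1) hκ0.le) (h s t hst)
  have hy : Continuous y := continuous_of_local_bound hκ0 hτ hloc
  have ys := hy.comp (continuous_fst (X := Icc (0 : ℝ) T) (Y := Icc (0 : ℝ) T))
  have yt := hy.comp (continuous_snd (X := Icc (0 : ℝ) T) (Y := Icc (0 : ℝ) T))
  have cσ := hc.field.differentiable.continuous
  have cF := hc.area.differentiable.continuous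
  have cx := hx.path.memC2.continuous
  have cL : Continuous fun p : Icc (0 : ℝ) T × Icc (0 : ℝ) T =>
      eulerRem σ (areaField σ) x A y p.1 p.2 :=
    (((cσ.comp ys).clm_apply cx).add ((cF.comp ys).clm_apply hx.area.continuous)).sub (yt.sub ys)
  obtain ⟨CL, hCL, bL⟩ := exists_bound_of_local cL (by positivity) hτ hN h
  obtain ⟨Cy, hCy, bY⟩ := exists_bound_of_local (g := delta1 y) (yt.sub ys) hκ0.le hτ
    (by positivity) hloc
  have rem_eq : ∀ s t, remainder x y (fun t => σ (y t)) s t =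
      areaField σ (y s) (A s t) - eulerRem σ (areaField σ) x A y s t := by
    intro s t
    simp only [remainder, delta1, eulerRem]
    abel
  have hctl : IsControlled κ x a y fun t => σ (y t) :=
    { path := ⟨hy, bddAbove_quot2 hCy bY⟩
      initial := h0
      derivative := by
        refine ⟨cσ.comp hy, bddAbove_quot2 (C := B * Cy) (by positivity) fun s t => ?_⟩
        refine (hc.field.lipschitz _ _).trans ?_
        rw [mul_assoc]
        exact mul_le_mul_of_nonneg_left (bY s t) hB
      remainder := by
        refine ⟨?_, fun s => ?_, bddAbove_quot2 (C := B * B + CL * T ^ (3 * κ - 2 * κ))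
          (by positivity) fun s t => ?_⟩
        · exact (yt.sub ys).sub ((cσ.comp ys).clm_apply cx)
        · simp [remainder, delta1]
        · rw [rem_eq, add_mul]
          refine (norm_sub_le _ _).trans (add_le_add ?_ ?_)
          · rw [mul_assoc]
            exact ContinuousLinearMap.le_of_opNorm_le_of_le _ (hc.area.bound _) (hb.area s t)
          · exact bound_of_exponent_le (g := eulerRem σ (areaField σ) x A y) (by linarith)
              (by linarith) hCL bL s t }
  have hζ : ∀ t, (fun t => σ (y t)) t = σ (y t) := fun _ => rfl
  refine ⟨hctl, hζ, eulerRem σ (areaField σ) x A y, ⟨⟨3 * κ, by linarith,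
    memC3_delta2_germ hκ0 hc hx hctl hζ, cL, fun s => ?_, bddAbove_quot2 hCL bL⟩, ?_⟩,
    fun s t => ?_⟩
  · simp [eulerRem, hx.area.diag]
  · funext s u t
    simp only [delta2, eulerRem_eq_germ_sub hζ, delta1]
    abel
  · rw [eulerRem_eq_germ_sub hζ, sub_sub_cancel]

/-- The remainder over an interval run backwards. -/
theorem norm_eulerRem_symm_le (hc : IsCoeff B σ (areaField σ)) (hx : IsRoughPath κ x A)
    (hb : RoughBound κ B x A) (hN : 0 ≤ N) {s t : Icc (0 : ℝ) T} (h1 : |(t : ℝ) - s| ^ κ ≤ 1)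
    (h : ‖eulerRem σ (areaField σ) x A y s t‖ ≤ N * |(t : ℝ) - s| ^ (3 * κ)) :
    ‖eulerRem σ (areaField σ) x A y t s‖ ≤
      (N + (7 * B ^ 6 + 2 * B ^ 2 * N)) * |(t : ℝ) - s| ^ (3 * κ) := by
  have hB := hc.nonneg
  rw [rpow_three_mul (abs_nonneg _)] at h ⊢
  have h0 : 0 ≤ |(t : ℝ) - s| ^ κ := by positivity
  have e := eulerRem_eq (hx.chenRel (σ := σ)) y s t s
  have e0 : eulerRem σ (areaField σ) x A y s s = 0 := by simp [eulerRem, hx.area.diag]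
  have e1 : eulerRem σ (areaField σ) x A y t s = defect σ (areaField σ) (y s) (y t) (x t - x s)
      (x s - x t) (A t s) - eulerRem σ (areaField σ) x A y s t := by
    rw [e0] at e
    rw [eq_sub_iff_add_eq, ← sub_eq_zero, e]
    abel
  have sym : |(s : ℝ) - t| ^ κ ≤ |(t : ℝ) - s| ^ κ := by rw [abs_sub_comm]
  have hd := hc.norm_defect_le (eq_of_eulerRem (σ := σ) (F := areaField σ) x A y s t) h0 h1
    (hb.path_le hB le_rfl) (hb.path_le hB sym) (hb.area_le hB le_rfl) (hb.area_le hB sym) h hN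
  rw [e1, add_mul, add_comm]
  refine (norm_sub_le _ _).trans (add_le_add (hd.trans ?_) h)
  have : 2 * B ^ 2 * N * |(t : ℝ) - s| ^ κ ≤ 2 * B ^ 2 * N :=
    mul_le_of_le_one_right (by positivity) h1
  gcongr

end Existence

/-! ### Limits of Euler schemes -/

section Limit

open Filter Topology

variable {T : ℝ} {d m : ℕ} {κ B : ℝ} {σ : Vec d → Mat d m} {x : Path1 T (Vec m)}
  {A : Path2 T (Area m)}

theorem tendsto_clm_apply {ι X Y : Type*} [NormedAddCommGroup X] [NormedSpace ℝ X]
    [NormedAddCommGroup Y] [NormedSpace ℝ Y] {l : Filter ι} {f : ι → X →L[ℝ] Y} {g : ι → X}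
    {f₀ : X →L[ℝ] Y} {g₀ : X} (hf : Tendsto f l (𝓝 f₀)) (hg : Tendsto g l (𝓝 g₀)) :
    Tendsto (fun i => f i (g i)) l (𝓝 (f₀ g₀)) :=
  ((isBoundedBilinearMap_apply (𝕜 := ℝ)).continuous.tendsto (f₀, g₀)).comp (hf.prodMk_nhds hg)

/-- The grid of step `δ` in `[0,T]`; the points beyond `T` are moved to `T`. -/
def gridPoint (hT : 0 ≤ T) (δ : ℝ) (k : ℕ) : Icc (0 : ℝ) T := projIcc 0 T hT (k * δ)

theorem abs_gridPoint_sub_le (hT : 0 ≤ T) {δ : ℝ} (hδ : 0 ≤ δ) (i n : ℕ) :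
    |(gridPoint hT δ (i + n) : ℝ) - gridPoint hT δ i| ≤ n * δ := by
  refine (abs_projIcc_sub_projIcc hT).trans ?_
  rw [show ((i + n : ℕ) * δ - i * δ : ℝ) = n * δ by push_cast; ring,
    abs_of_nonneg (by positivity)]

theorem coe_gridPoint_floor (hT : 0 ≤ T) {δ : ℝ} (hδ : 0 < δ) (t : Icc (0 : ℝ) T) :
    (gridPoint hT δ ⌊(t : ℝ) / δ⌋₊ : ℝ) = ⌊(t : ℝ) / δ⌋₊ * δ := by
  have h1 : (⌊(t : ℝ) / δ⌋₊ : ℝ) * δ ≤ t := by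
    rw [← le_div_iff₀ hδ]
    exact Nat.floor_le (div_nonneg t.2.1 hδ.le)
  rw [gridPoint, projIcc_of_mem hT ⟨by positivity, h1.trans t.2.2⟩]

theorem abs_gridPoint_floor_sub_le (hT : 0 ≤ T) {δ : ℝ} (hδ : 0 < δ) (t : Icc (0 : ℝ) T) :
    |(gridPoint hT δ ⌊(t : ℝ) / δ⌋₊ : ℝ) - t| ≤ δ := by
  have h1 : (⌊(t : ℝ) / δ⌋₊ : ℝ) * δ ≤ t := by
    rw [← le_div_iff₀ hδ]
    exact Nat.floor_le (div_nonneg t.2.1 hδ.le)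
  have h2 : (t : ℝ) < (⌊(t : ℝ) / δ⌋₊ + 1) * δ := by
    rw [← div_lt_iff₀ hδ]
    exact Nat.lt_floor_add_one _
  rw [coe_gridPoint_floor hT hδ, abs_sub_comm, abs_of_nonneg (by linarith)]
  linarith

/-- A path with third-order remainder over all small forward intervals, as a limit of the Euler
schemes along an ultrafilter: at each time, the schemes stay in a compact ball. -/
theorem exists_path_eulerRem_le (hκ : 1 / 3 < κ) (hT : 0 < T) (hc : IsCoeff B σ (areaField σ))
    (hx : IsRoughPath κ x A) (hb : RoughBound κ B x A) (a : Vec d) :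
    ∃ y : Path1 T (Vec d), (∀ t : Icc (0 : ℝ) T, (t : ℝ) = 0 → y t = a) ∧
      ∀ s t : Icc (0 : ℝ) T, (s : ℝ) ≤ t → |(t : ℝ) - s| ^ κ < smallScale κ B →
        ‖eulerRem σ (areaField σ) x A y s t‖ ≤ remConst κ B * |(t : ℝ) - s| ^ (3 * κ) := by
  have hκ0 : 0 < κ := by linarith
  have hB1 := hc.one_le
  have hB := hc.nonneg
  have hε := smallScale_pos hκ hB1
  set K := coverNum κ T (smallScale κ B) with hK
  have hK0 : 0 < K := by simp [hK, coverNum]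
  have hK0' : (0 : ℝ) < K := by exact_mod_cast hK0
  let δ : ℕ → ℝ := fun n => T / (K * (n + 1))
  have hδ : ∀ n, 0 < δ n := fun n => by positivity
  have hδ0 : Tendsto δ atTop (𝓝 0) := by
    have h1 : Tendsto (fun n : ℕ => T / K * (1 / ((n : ℝ) + 1))) atTop (𝓝 (T / K * 0)) :=
      tendsto_one_div_add_atTop_nhds_zero_nat.const_mul _
    rw [mul_zero] at h1
    refine h1.congr fun n => ?_
    simp only [δ]
    field_simp
  let P : ℕ → ℕ → Icc (0 : ℝ) T := fun n => gridPoint hT.le (δ n)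
  let X : ℕ → ℕ → Vec m := fun n k => x (P n k)
  let 𝔸 : ℕ → ℕ → ℕ → Area m := fun n k l => A (P n k) (P n l)
  let e : ℕ → ℕ → Vec d := fun n => eulerScheme σ (areaField σ) a (X n) (𝔸 n)
  have hch : ∀ n, ChenRel σ (areaField σ) (X n) (𝔸 n) := fun n => (hx.chenRel (σ := σ)).comp (P n)
  have hA0 : ∀ n i, 𝔸 n i i = 0 := fun n i => hx.area.diag _
  have hinc : ∀ n i k : ℕ, |(P n (i + k) : ℝ) - P n i| ^ κ ≤ (k * δ n) ^ κ := fun n i k =>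
    Real.rpow_le_rpow (abs_nonneg _) (abs_gridPoint_sub_le hT.le (hδ n).le i k) hκ0.le
  have hX : ∀ n i k : ℕ, ‖X n (i + k) - X n i‖ ≤ B * (k * δ n) ^ κ := fun n i k =>
    hb.path_le hB (hinc n i k)
  have hAA : ∀ n i k : ℕ, ‖𝔸 n i (i + k)‖ ≤ B * ((k * δ n) ^ κ) ^ 2 := fun n i k =>
    hb.area_le hB (hinc n i k)
  let I : ℕ → Icc (0 : ℝ) T → ℕ := fun n t => ⌊(t : ℝ) / δ n⌋₊
  have hI : ∀ n t, I n t ≤ K * (n + 1) := by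
    intro n t
    refine Nat.floor_le_of_le ?_
    rw [div_le_iff₀ (hδ n)]
    refine t.2.2.trans (le_of_eq ?_)
    simp only [δ]
    push_cast
    field_simp
  -- one block of `n + 1` steps has length `T / K`, which is below the small scale
  have hblock : ∀ n : ℕ, ((n + 1 : ℕ) * δ n) ^ κ ≤ smallScale κ B := by
    intro n
    rw [rpow_le_iff_le_scale hκ0 hε (by have := (hδ n).le; positivity)]
    have h1 : ((n + 1 : ℕ) * δ n : ℝ) = T / K := by
      simp only [δ]
      push_cast
      field_simp
    rw [h1, div_le_iff₀ hK0', mul_comm]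
    exact le_coverNum hε T
  have hbd : ∀ n t, e n (I n t) ∈ Metric.closedBall a ((K + 1) * (2 * B ^ 2 + remConst κ B)) :=
    fun n t => by
      rw [mem_closedBall_iff_norm]
      exact norm_eulerScheme_le hκ (hδ n).le hc a (hch n) (hA0 n) (hX n) (hAA n)
        (Nat.succ_pos n) (hblock n) (hI n t)
  have hlim : ∀ t, ∃ z, Tendsto (fun n => e n (I n t)) (hyperfilter ℕ : Filter ℕ) (𝓝 z) := by
    intro t
    obtain ⟨z, -, hz⟩ := (isCompact_closedBall a _).ultrafilter_le_nhds
      ((hyperfilter ℕ).map fun n => e n (I n t))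
      (tendsto_principal.2 (Filter.Eventually.of_forall fun n => hbd n t))
    exact ⟨z, hz⟩
  choose y hy using hlim
  have hle : (hyperfilter ℕ : Filter ℕ) ≤ atTop := by
    rw [← Nat.cofinite_eq_atTop]; exact hyperfilter_le_cofinite
  have hgrid : ∀ t, Tendsto (fun n => P n (I n t)) (hyperfilter ℕ : Filter ℕ) (𝓝 t) := by
    intro t
    rw [tendsto_iff_dist_tendsto_zero]
    refine squeeze_zero (fun n => dist_nonneg) (fun n => ?_) (hδ0.mono_left hle)
    exact abs_gridPoint_floor_sub_le hT.le (hδ n) t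
  refine ⟨y, fun t ht => ?_, fun s t hst hε' => ?_⟩
  · have h1 : ∀ n, e n (I n t) = a := fun n => by simp [I, e, ht, eulerScheme]
    have h2 := hy t
    simp only [h1] at h2
    exact tendsto_nhds_unique h2 tendsto_const_nhds
  · have cσ := hc.field.differentiable.continuous
    have cF := hc.area.differentiable.continuous
    have lσ : Tendsto (fun n => σ (e n (I n s))) (hyperfilter ℕ : Filter ℕ) (𝓝 (σ (y s))) :=
      (cσ.tendsto _).comp (hy s)
    have lF : Tendsto (fun n => areaField σ (e n (I n s))) (hyperfilter ℕ : Filter ℕ)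
        (𝓝 (areaField σ (y s))) := (cF.tendsto _).comp (hy s)
    have lx : ∀ t, Tendsto (fun n => X n (I n t)) (hyperfilter ℕ : Filter ℕ) (𝓝 (x t)) :=
      fun t => (hx.path.continuous.tendsto t).comp (hgrid t)
    have lA : Tendsto (fun n => 𝔸 n (I n s) (I n t)) (hyperfilter ℕ : Filter ℕ) (𝓝 (A s t)) :=
      (hx.area.continuous.tendsto (s, t)).comp ((hgrid s).prodMk_nhds (hgrid t))
    have l1 : Tendsto (fun n => eulerRem σ (areaField σ) (X n) (𝔸 n) (e n) (I n s) (I n t))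
        (hyperfilter ℕ : Filter ℕ) (𝓝 (eulerRem σ (areaField σ) x A y s t)) :=
      ((tendsto_clm_apply lσ ((lx t).sub (lx s))).add (tendsto_clm_apply lF lA)).sub ((hy t).sub (hy s))
    have hIle : ∀ n, I n s ≤ I n t := fun n =>
      Nat.floor_le_floor (div_le_div_of_nonneg_right hst (hδ n).le)
    have hlen : ∀ n, (((I n t - I n s : ℕ) : ℝ) * δ n) = (P n (I n t) : ℝ) - P n (I n s) := by
      intro n
      rw [Nat.cast_sub (hIle n), sub_mul]
      simp only [P, I]
      rw [coe_gridPoint_floor hT.le (hδ n), coe_gridPoint_floor hT.le (hδ n)]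
    have l2 : Tendsto (fun n => ((I n t - I n s : ℕ) : ℝ) * δ n) (hyperfilter ℕ : Filter ℕ)
        (𝓝 |(t : ℝ) - s|) := by
      rw [abs_of_nonneg (sub_nonneg.2 hst)]
      simp only [hlen]
      exact ((continuous_subtype_val.tendsto t).comp (hgrid t)).sub
        ((continuous_subtype_val.tendsto s).comp (hgrid s))
    have l3 := l2.rpow_const (p := κ) (Or.inr hκ0.le)
    have l4 := (l2.rpow_const (p := 3 * κ) (Or.inr (by positivity))).const_mul (remConst κ B)
    refine le_of_tendsto_of_tendsto l1.norm l4 ?_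
    filter_upwards [l3.eventually (gt_mem_nhds hε')] with n hn
    have := norm_eulerRem_eulerScheme_le hκ (hδ n).le hc a (hch n) (hA0 n) (hX n) (hAA n)
      (I n t - I n s) (I n s) hn.le
    rwa [Nat.add_sub_cancel' (hIle n)] at this

theorem exists_isSolution (hκ : 1 / 3 < κ) (hT : 0 < T) (hc : IsCoeff B σ (areaField σ))
    (hx : IsRoughPath κ x A) (hb : RoughBound κ B x A) (a : Vec d) :
    ∃ y : Path1 T (Vec d), IsSolution κ σ a x A y fun t => σ (y t) := by
  obtain ⟨y, hy0, hy⟩ := exists_path_eulerRem_le hκ hT hc hx hb a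
  have hB1 := hc.one_le
  have hB := hc.nonneg
  have hε := smallScale_pos hκ hB1
  have hε1 := smallScale_le_one (κ := κ) hB1
  have hQ := remConst_pos hκ hB1
  have hτ : 0 < (smallScale κ B / 2) ^ (1 / κ) := Real.rpow_pos_of_pos (by positivity) _
  refine ⟨y, isSolution_of_local hκ hT.le hc hx hb hy0 hτ
    (Real.rpow_le_one (by positivity) (by linarith) (by positivity))
    (N := remConst κ B + (7 * B ^ 6 + 2 * B ^ 2 * remConst κ B)) (by positivity)
    fun s t hst => ?_⟩
  have hlt : |(t : ℝ) - s| ^ κ < smallScale κ B := by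
    have := (rpow_le_iff_le_scale (by linarith) (by positivity) (abs_nonneg _)).2 hst
    linarith
  rcases le_total (s : ℝ) t with h | h
  · refine (hy s t h hlt).trans ?_
    gcongr
    exact le_add_of_nonneg_right (by positivity)
  · rw [abs_sub_comm] at hlt ⊢
    exact norm_eulerRem_symm_le hc hx hb hQ.le (hlt.le.trans hε1) (hy t s h hlt)

end Limit

end RDE

end

theorem theorem2p5 {d m : ℕ} {κ γ : ℝ} (hκ : 1 / 3 < κ) (hκγ : κ < γ) (hγ : γ ≤ 1)
    {σ : RDE.Vec d → RDE.Mat d m} (hσ : ContDiff ℝ 3 σ)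
    (hσb : ∀ k : ℕ, k ≤ 3 → ∃ M : ℝ, ∀ v, ‖iteratedFDeriv ℝ k σ v‖ ≤ M)
    {T : ℝ} (hT : 0 < T) :
    (∃ P : MvPolynomial (Fin 2) ℝ, (∀ v, 0 ≤ MvPolynomial.eval v P) ∧
      ∀ (a : RDE.Vec d) (x : RDE.Path1 T (RDE.Vec m)) (A : RDE.Path2 T (RDE.Area m)),
        RDE.IsRoughPath γ x A →
        (∃! p : RDE.Path1 T (RDE.Vec d) × RDE.Path1 T (RDE.Mat d m),
          RDE.IsSolution κ σ a x A p.1 p.2) ∧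
        ∀ y ζ, RDE.IsSolution κ σ a x A y ζ →
          RDE.controlledNorm κ x y ζ ≤
            MvPolynomial.eval ![RDE.holderNorm γ x, RDE.norm2 (2 * γ) A] P) ∧
    (∀ (a : RDE.Vec d) (x : RDE.Path1 T (RDE.Vec m)) (A : RDE.Path2 T (RDE.Area m)),
      RDE.IsRoughPath γ x A →
      ∀ y ζ, RDE.IsSolution κ σ a x A y ζ → RDE.MemC1 γ y) ∧
    (∃ K : (Fin 4 → ℝ) → ℝ, Monotone K ∧ (∀ v, 0 ≤ K v) ∧
      ∀ (a a' : RDE.Vec d) (x x' : RDE.Path1 T (RDE.Vec m))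
        (A A' : RDE.Path2 T (RDE.Area m)),
        RDE.IsRoughPath γ x A → RDE.IsRoughPath γ x' A' →
        ∀ y ζ y' ζ', RDE.IsSolution κ σ a x A y ζ → RDE.IsSolution κ σ a' x' A' y' ζ' →
          RDE.holderNorm γ (y - y') ≤
            K ![RDE.holderNorm γ x, RDE.holderNorm γ x',
                RDE.norm2 (2 * γ) A, RDE.norm2 (2 * γ) A'] *
              (‖a - a'‖ + RDE.holderNorm γ (x - x') + RDE.norm2 (2 * γ) (A - A'))) := by
  obtain ⟨B, hc⟩ := RDE.exists_isCoeff hσ hσb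
  have hκ0 : 0 ≤ κ := by linarith
  have hγ0 : 0 ≤ γ := by linarith
  have hB1 := hc.one_le
  have hB0 := hc.nonneg
  choose C hC0 hC using fun R : ℕ =>
    RDE.exists_lipschitz_const hκ hκγ hγ hT hc (R := R) (Nat.cast_nonneg R)
  set c := RDE.embedConst T κ γ with hcdef
  have hc1 : 1 ≤ c := RDE.one_le_embedConst hT.le
  have hc0 : 0 ≤ c := zero_le_one.trans hc1
  -- the bound for the coefficients and the rough path in terms of the Hölder norms
  have data : ∀ (x : RDE.Path1 T (RDE.Vec m)) (A : RDE.Path2 T (RDE.Area m)),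
      RDE.IsRoughPath γ x A →
      RDE.IsCoeff (B * c * (1 + RDE.holderNorm γ x ^ 2 + RDE.norm2 (2 * γ) A ^ 2)) σ
        (RDE.areaField σ) ∧
      RDE.RoughBound κ (B * c * (1 + RDE.holderNorm γ x ^ 2 + RDE.norm2 (2 * γ) A ^ 2)) x A := by
    intro x A hx
    set X := RDE.holderNorm γ x
    set Y := RDE.norm2 (2 * γ) A
    have h1 : RDE.RoughBound γ (1 + X ^ 2 + Y ^ 2) x A :=
      .of_memC hx.path hx.area (by nlinarith [sq_nonneg (X - 1), sq_nonneg Y])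
        (by nlinarith [sq_nonneg (Y - 1), sq_nonneg X])
    have h2 : 1 ≤ 1 + X ^ 2 + Y ^ 2 := by nlinarith [sq_nonneg X, sq_nonneg Y]
    refine ⟨hc.mono ?_, (h1.of_exponent_le hT.le hκ0 hκγ.le (by positivity)).mono ?_⟩
    · rw [mul_assoc]
      exact le_mul_of_one_le_right hB0 (one_le_mul_of_one_le_of_one_le hc1 h2)
    · rw [← hcdef, mul_assoc]
      exact le_mul_of_one_le_left (by positivity) hB1
  have hpc : 0 ≤ RDE.polyConst κ T := by
    have := RDE.sewGap_pos hκ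
    unfold RDE.polyConst
    positivity
  refine ⟨⟨MvPolynomial.C (RDE.polyConst κ T * (B * c) ^ 14) *
    (1 + MvPolynomial.X 0 ^ 2 + MvPolynomial.X 1 ^ 2) ^ 14, fun v => ?_, ?_⟩, ?_, ?_⟩
  · simp only [map_mul, map_pow, map_add, map_one, MvPolynomial.eval_C, MvPolynomial.eval_X]
    positivity
  · intro a x A hx
    obtain ⟨hcoeff, hbound⟩ := data x A hx
    have hxκ := hx.mono hT.le hκ0 hκγ.le
    refine ⟨?_, fun y ζ hy => ?_⟩
    · obtain ⟨y, hy⟩ := RDE.exists_isSolution hκ hT hcoeff hxκ hbound a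
      refine ⟨(y, fun t => σ (y t)), hy, ?_⟩
      rintro ⟨y', ζ'⟩ hy'
      -- uniqueness is the stability estimate for equal data
      obtain ⟨R, hR⟩ := exists_nat_ge (max (RDE.holderNorm γ x) (RDE.norm2 (2 * γ) A))
      have h1 := (le_max_left _ _).trans hR
      have h2 := (le_max_right _ _).trans hR
      have hle := hC R a a x x A A hx hx h1 h1 h2 h2 y' ζ' y _ hy' hy
      have z1 : RDE.holderNorm γ (x - x) = 0 := by
        simp [RDE.holderNorm, RDE.supNorm, RDE.norm2, RDE.quot2, RDE.delta1]
      have z2 : RDE.norm2 (2 * γ) (A - A) = 0 := by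
        simp [RDE.norm2, RDE.quot2]
      rw [z1, z2, sub_self, norm_zero, add_zero, add_zero, mul_zero] at hle
      have hcont : Continuous (y' - y) :=
        hy'.controlled.path.continuous.sub hy.controlled.path.continuous
      have hbdd : BddAbove (Set.range fun t => ‖(y' - y) t‖) :=
        (isCompact_range hcont.norm).bddAbove
      have hyy : y' = y := by
        funext t
        have h3 : ‖(y' - y) t‖ ≤ RDE.supNorm (y' - y) := le_ciSup hbdd t
        have h4 : RDE.supNorm (y' - y) ≤ RDE.holderNorm γ (y' - y) :=
          le_add_of_nonneg_right RDE.norm2_nonneg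
        exact sub_eq_zero.1 (norm_le_zero_iff.1 ((h3.trans h4).trans hle))
      subst hyy
      exact Prod.ext rfl (funext hy'.derivative)
    · refine (hy.controlledNorm_le hκ hT.le hcoeff hxκ hbound).trans (le_of_eq ?_)
      simp only [map_mul, map_pow, map_add, map_one, MvPolynomial.eval_C, MvPolynomial.eval_X,
        Matrix.cons_val_zero, Matrix.cons_val_one]
      ring
  · intro a x A hx y ζ hy
    exact hy.memC1 hT.le hγ0 hγ hc hx
  · -- `K` sums the constants attached to the integers up to a bound for all four norms
    let n : (Fin 4 → ℝ) → ℕ := fun v => ⌈v 0⌉₊ + ⌈v 1⌉₊ + ⌈v 2⌉₊ + ⌈v 3⌉₊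
    refine ⟨fun v => ∑ k ∈ Finset.range (n v + 1), C k, fun v w hvw => ?_, fun v =>
      Finset.sum_nonneg fun k _ => hC0 k, ?_⟩
    · refine Finset.sum_le_sum_of_subset_of_nonneg (Finset.range_mono ?_) fun k _ _ => hC0 k
      have h : ∀ i, ⌈v i⌉₊ ≤ ⌈w i⌉₊ := fun i => Nat.ceil_mono (hvw i)
      have h0 := h 0
      have h1 := h 1
      have h2 := h 2
      have h3 := h 3
      simp only [n]
      omega
    · intro a a' x x' A A' hx hx' y ζ y' ζ' hy hy'
      set v : Fin 4 → ℝ := ![RDE.holderNorm γ x, RDE.holderNorm γ x', RDE.norm2 (2 * γ) A,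
        RDE.norm2 (2 * γ) A'] with hv
      have hle : ∀ i, v i ≤ n v := fun i => by
        refine (Nat.le_ceil _).trans (Nat.cast_le.2 ?_)
        fin_cases i
        exacts [show ⌈v 0⌉₊ ≤ ⌈v 0⌉₊ + ⌈v 1⌉₊ + ⌈v 2⌉₊ + ⌈v 3⌉₊ by omega,
          show ⌈v 1⌉₊ ≤ ⌈v 0⌉₊ + ⌈v 1⌉₊ + ⌈v 2⌉₊ + ⌈v 3⌉₊ by omega,
          show ⌈v 2⌉₊ ≤ ⌈v 0⌉₊ + ⌈v 1⌉₊ + ⌈v 2⌉₊ + ⌈v 3⌉₊ by omega,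
          show ⌈v 3⌉₊ ≤ ⌈v 0⌉₊ + ⌈v 1⌉₊ + ⌈v 2⌉₊ + ⌈v 3⌉₊ by omega]
      have hsum : C (n v) ≤ ∑ k ∈ Finset.range (n v + 1), C k :=
        Finset.single_le_sum (fun k _ => hC0 k) (Finset.self_mem_range_succ _)
      refine (hC (n v) a a' x x' A A' hx hx' (hle 0) (hle 1) (hle 2) (hle 3)
        y ζ y' ζ' hy hy').trans ?_
      have n1 : 0 ≤ RDE.holderNorm γ (x - x') := add_nonneg RDE.supNorm_nonneg RDE.norm2_nonneg
      have n2 := RDE.norm2_nonneg (μ := 2 * γ) (g := A - A')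
      gcongr
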